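/- Let $\mathcal V$ be a category with pullbacks which is cartesian closed and (infinitary) extensive, i.e. $\mathcal V$ has all small coproducts and for every set $I$ and every family $(X_i)_{i\in I}$ of objects the coproduct functor $\prod_{i\in I}\mathcal V_{/X_i}\to\mathcal V_{/\bigsqcup_{i\in I}X_i}$ is an equivalence. Write $*$ for the terminal object of $\mathcal V$ and $[-,-]$ for its internal hom, and regard $\mathcal V$ as enriched over itself. Let $\mathcal C$ be a $\mathcal V$-category with a set of objects, with composition maps $c_{A,B,D}\colon \mathcal C(A,B)\times\mathcal C(B,D)\to\mathcal C(A,D)$ and identities $i_A\colon *\to\mathcal C(A,A)$. Let $F\colon\mathcal C^{\mathrm{op}}\to\mathcal V$ be a $\mathcal V$-functor, with action maps $\mathrm{ev}_{A,B}\colon\mathcal C(A,B)\times FB\to FA$ (the transposes of $\mathcal C(A,B)\to[FB,FA]$), let $C$ be an object of $\mathcal C$, and let $x\colon *\to FC$ be an element. We say that $F$ is *$\mathcal V$-representable by $(C,x)$* if the $\mathcal V$-natural transformation $\alpha\colon\mathcal C(-,C)\Rightarrow F$ corresponding to $x$ under the enriched Yoneda lemma (the one for which $*\xrightarrow{i_C}\mathcal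 C(C,C)\xrightarrow{\alpha_C}FC$ equals $x$) is a $\mathcal V$-natural isomorphism. The *internal category of elements* $\int_{\mathcal C}F$ is the category internal to $\mathcal V$ with object of objects $\bigsqcup_{A\in\mathcal C}FA$ and object of morphisms $\bigsqcup_{A,B\in\mathcal C}\mathcal C(A,B)\times FB$, whose source map is induced by $\mathrm{ev}_{A,B}\colon\mathcal C(A,B)\times FB\to FA$, whose target map is induced by the projections $\mathcal C(A,B)\times FB\to FB$, whose identity map is induced by $i_A\times \mathrm{id}\colon FA\to\mathcal C(A,A)\times FA$, and whose composition is induced by $c_{A,B,D}\times\mathrm{id}\colon\mathcal C(A,B)\times\mathcal C(B,D)\times FD\to\mathcal C(A,D)\times FD$. The element $x\colon *\to FC\hookrightarrow\bigsqcup_{A}FA$ defines an internal functor $(C,x)\colon *\to\int_{\mathcal C}F$ from the terminal internal category. For a category $\mathbb A$ internal to $\mathcal V$, let $\mathbb A^{\mathbb 2}$ be its internal category of arrows (objects are the morphisms of $\mathbb A$, morphisms are the commutative squares in $\mathbb A$), with source and target functors to $\mathbb A$. For $T\colon *\to\mathbb A$, the *slice* $\mathbb A_{/T}$ is the pullback of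 $(\mathrm{source},\mathrm{target})\colon\mathbb A^{\mathbb 2}\to\mathbb A\times\mathbb A$ along $(\mathrm{id},T)\colon\mathbb A\cong\mathbb A\times *\to\mathbb A\times\mathbb A$ in the category of internal categories. We call $T$ an *internal terminal object* of $\mathbb A$ if the projection $\mathbb A_{/T}\to\mathbb A$ is an isomorphism of internal categories. Then the following are equivalent: 1. $F$ is $\mathcal V$-representable by $(C,x)$; 2. $(C,x)$ is an internal terminal object of $\int_{\mathcal C}F$. -/

import Mathlib

open CategoryTheory Limits MonoidalCategory CartesianMonoidalCategory Opposite
open scoped MonoidalClosed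

universe w v u

noncomputable section

namespace VRep

section Coproducts

variable {V : Type u} [Category.{v} V]

/-- The coproduct functor `∏ᵢ V/Xᵢ ⥤ V/(⨆ᵢ Xᵢ)`. -/
def sigmaOver [HasCoproducts.{w} V] {I : Type w} (X : I → V) :
    (∀ i, Over (X i)) ⥤ Over (∐ X) where
  obj Y := Over.mk (Limits.Sigma.map fun i => (Y i).hom)
  map φ := Over.homMk (Limits.Sigma.map fun i => (φ i).left) (by
    apply Sigma.hom_ext
    intro i
    simp)
  map_id Y := by
    apply Over.OverMorphism.ext
    apply Sigma.hom_ext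
    intro i
    simp
  map_comp φ ψ := by
    apply Over.OverMorphism.ext
    apply Sigma.hom_ext
    intro i
    simp

/-- (Infinitary) extensive categories. -/
class IsExtensive (V : Type u) [Category.{v} V] : Prop where
  hasCoproducts : HasCoproducts.{w} V
  isEquivalence : ∀ (I : Type w) (X : I → V), (sigmaOver X).IsEquivalence

attribute [instance] IsExtensive.hasCoproducts IsExtensive.isEquivalence

section Extensive

variable [IsExtensive.{w} V] {I : Type w}

theorem sigma_full {Y S W : I → V} (p : ∀ k, S k ⟶ Y k) (q : ∀ k, W k ⟶ Y k)
    (m : ∐ S ⟶ ∐ W) (hm : m ≫ Limits.Sigma.map q = Limits.Sigma.map p) :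
    ∃ φ : ∀ k, S k ⟶ W k, (∀ k, φ k ≫ q k = p k) ∧ Limits.Sigma.map φ = m := by
  let m' : (sigmaOver Y).obj (fun k => Over.mk (p k)) ⟶
    (sigmaOver Y).obj (fun k => Over.mk (q k)) := Over.homMk m hm
  obtain ⟨φ, hφ⟩ := (sigmaOver Y).map_surjective m'
  exact ⟨fun k => (φ k).left, fun k => Over.w (φ k), congrArg (fun t => t.left) hφ⟩

theorem sigma_faithful {Y S W : I → V} (q : ∀ k, W k ⟶ Y k) (φ ψ : ∀ k, S k ⟶ W k)
    (h : ∀ k, φ k ≫ q k = ψ k ≫ q k) (e : Limits.Sigma.map φ = Limits.Sigma.map ψ) : φ = ψ := by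
  let A : ∀ k, Over (Y k) := fun k => Over.mk (φ k ≫ q k)
  let B : ∀ k, Over (Y k) := fun k => Over.mk (q k)
  let φ' : A ⟶ B := fun k => Over.homMk (φ k) rfl
  let ψ' : A ⟶ B := fun k => Over.homMk (ψ k) (h k).symm
  have e' : φ' = ψ' := (sigmaOver Y).map_injective (Over.OverMorphism.ext e)
  funext k
  exact congrArg (fun t : A ⟶ B => (t k).left) e'

theorem sigma_essSurj {Y : I → V} {X : V} (f : X ⟶ ∐ Y) :
    ∃ (W : I → V) (p : ∀ k, W k ⟶ Y k) (e : ∐ W ≅ X), e.hom ≫ f = Limits.Sigma.map p := by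
  let e := (sigmaOver Y).objObjPreimageIso (Over.mk f)
  exact ⟨fun k => ((sigmaOver Y).objPreimage (Over.mk f) k).left,
    fun k => ((sigmaOver Y).objPreimage (Over.mk f) k).hom,
    (Over.forget _).mapIso e, Over.w e.hom⟩

/-- The family with `U` at the index `i` and the initial object elsewhere. -/
def single (i : I) (U : V) (k : I) : V := ∐ fun _ : ULift.{w} (PLift (i = k)) => U

def singleι (i : I) (U : V) : U ⟶ single i U i :=
  Sigma.ι (fun _ : ULift.{w} (PLift (i = i)) => U) ⟨⟨rfl⟩⟩

def singleDesc {Z : I → V} {i : I} {U : V} (b : U ⟶ Z i) (k : I) : single i U k ⟶ Z k :=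
  Sigma.desc fun t => b ≫ eqToHom (congrArg Z t.down.down)

theorem singleι_desc {Z : I → V} {i : I} {U : V} (b : U ⟶ Z i) :
    singleι i U ≫ singleDesc b i = b := by
  refine (Sigma.ι_desc (f := fun _ : ULift.{w} (PLift (i = i)) => U) _ _).trans ?_
  rw [eqToHom_refl, Category.comp_id]

theorem single_hom_ext {i : I} {U : V} {T : I → V} (b c : ∀ k, single i U k ⟶ T k)
    (h : singleι i U ≫ b i = singleι i U ≫ c i) (k : I) : b k = c k := by
  apply Sigma.hom_ext
  rintro ⟨⟨e⟩⟩
  subst e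
  exact h

/-- In an extensive category, a map into a coproduct over a coproduct inclusion factors uniquely. -/
theorem exists_unique_lift {Y W : I → V} (p : ∀ i, W i ⟶ Y i) (i : I) {U : V}
    (a : U ⟶ ∐ W) (g : U ⟶ Y i) (h : a ≫ Limits.Sigma.map p = g ≫ Sigma.ι Y i) :
    ∃ l : U ⟶ W i, (l ≫ Sigma.ι W i = a ∧ l ≫ p i = g) ∧
      ∀ l' : U ⟶ W i, l' ≫ Sigma.ι W i = a → l' ≫ p i = g → l' = l := by
  have s1 := singleι_desc (Z := fun _ : I => ∐ W) (i := i) a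
  have hm : (Sigma.desc (singleDesc (Z := fun _ : I => ∐ W) (i := i) a)) ≫
      Limits.Sigma.map p = Limits.Sigma.map (singleDesc g) := by
    apply Sigma.hom_ext
    intro k
    rw [Sigma.ι_desc_assoc, Sigma.ι_map]
    refine single_hom_ext (T := fun _ => ∐ Y)
      (fun k => singleDesc (Z := fun _ : I => ∐ W) (i := i) a k ≫ Limits.Sigma.map p)
      (fun k => singleDesc g k ≫ Sigma.ι Y k) ?_ k
    rw [reassoc_of% s1, reassoc_of% singleι_desc (Z := Y) g, h]
  obtain ⟨φ, h1, h2⟩ := sigma_full _ _ _ hm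
  refine ⟨singleι i U ≫ φ i, ⟨?_, ?_⟩, ?_⟩
  · have h3 := congrArg (fun t => Sigma.ι _ i ≫ t) h2
    simp only [Sigma.ι_map, Sigma.ι_desc] at h3
    rw [Category.assoc, h3, s1]
  · rw [Category.assoc, h1, singleι_desc]
  · intro l' h3 h4
    have e : singleDesc l' = φ := by
      refine sigma_faithful p _ _ ?_ ?_
      · intro k
        rw [h1]
        refine single_hom_ext (T := Y) (fun k => singleDesc l' k ≫ p k) (singleDesc g) ?_ k
        rw [reassoc_of% singleι_desc (Z := W) l', singleι_desc, h4]
      · rw [h2]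
        apply Sigma.hom_ext
        intro k
        rw [Sigma.ι_desc, Sigma.ι_map]
        refine single_hom_ext (T := fun _ => ∐ W) (fun k => singleDesc l' k ≫ Sigma.ι W k)
          (singleDesc (Z := fun _ : I => ∐ W) a) ?_ k
        rw [reassoc_of% singleι_desc (Z := W) l', s1, h3]
    rw [← e, singleι_desc]

/-- Any map `X ⟶ ⨆ᵢ Yᵢ` decomposes `X` as a coproduct, in a way stable under pullback. -/
theorem exists_cover {Y : I → V} {X : V} (f : X ⟶ ∐ Y) :
    ∃ (W : I → V) (j : ∀ k, W k ⟶ X) (p : ∀ k, W k ⟶ Y k),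
      Nonempty (IsColimit (Cofan.mk X j)) ∧ ∀ k, IsPullback (j k) (p k) f (Sigma.ι Y k) := by
  obtain ⟨W, p, e, he⟩ := sigma_essSurj f
  refine ⟨W, fun k => Sigma.ι W k ≫ e.hom, p, ⟨?_⟩, fun k => ?_⟩
  · exact IsColimit.ofIsoColimit (coproductIsCoproduct W) (Cofan.ext e fun k => rfl)
  · refine ⟨⟨by rw [Category.assoc, he, Sigma.ι_map]⟩, ⟨PullbackCone.IsLimit.mk _
      (fun s => (exists_unique_lift p k (s.fst ≫ e.inv) s.snd
        (by rw [← he]; simpa using s.condition)).choose) ?_ ?_ ?_⟩⟩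
    · intro s
      have := (exists_unique_lift p k (s.fst ≫ e.inv) s.snd
        (by rw [← he]; simpa using s.condition)).choose_spec.1.1
      rw [← Category.assoc, this, Category.assoc, e.inv_hom_id, Category.comp_id]
    · exact fun s => (exists_unique_lift p k (s.fst ≫ e.inv) s.snd
        (by rw [← he]; simpa using s.condition)).choose_spec.1.2
    · intro s m h1 h2
      refine (exists_unique_lift p k (s.fst ≫ e.inv) s.snd
        (by rw [← he]; simpa using s.condition)).choose_spec.2 m ?_ h2
      rw [← h1]
      simp

/-- Two maps out of `X` agree if they agree on the pieces of a decomposition of `X`. -/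
theorem cover_hom_ext {Y : I → V} {X Z : V} (f : X ⟶ ∐ Y) {a b : X ⟶ Z}
    (H : ∀ (k : I) (U : V) (r : U ⟶ X) (q : U ⟶ Y k), r ≫ f = q ≫ Sigma.ι Y k →
      r ≫ a = r ≫ b) : a = b := by
  obtain ⟨W, j, p, ⟨hc⟩, hp⟩ := exists_cover f
  exact Cofan.IsColimit.hom_ext hc _ _ fun k => H k (W k) (j k) (p k) (hp k).w

/-- Gluing of locally defined maps out of `X`. -/
theorem glue {Y : I → V} {X Z : V} (f : X ⟶ ∐ Y)
    (P : ∀ {U : V}, (U ⟶ X) → (U ⟶ Z) → Prop)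
    (H : ∀ (k : I) (U : V) (r : U ⟶ X) (q : U ⟶ Y k), r ≫ f = q ≫ Sigma.ι Y k →
      ∃ t : U ⟶ Z, ∀ (U' : V) (s : U' ⟶ U), P (s ≫ r) (s ≫ t)) :
    ∃ m : X ⟶ Z, ∀ (k : I) (U : V) (r : U ⟶ X) (q : U ⟶ Y k), r ≫ f = q ≫ Sigma.ι Y k →
      P r (r ≫ m) := by
  obtain ⟨W, j, p, ⟨hc⟩, hp⟩ := exists_cover f
  choose t ht using fun k => H k (W k) (j k) (p k) (hp k).w
  refine ⟨Cofan.IsColimit.desc hc t, fun k U r q h => ?_⟩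
  have h1 : j k ≫ Cofan.IsColimit.desc hc t = t k := Cofan.IsColimit.fac hc t k
  have h2 := ht k U ((hp k).lift r q h)
  rwa [(hp k).lift_fst, ← h1, ← Category.assoc, (hp k).lift_fst] at h2

theorem single_retract {Y : I → V} {U : V} {i i' : I} (g : U ⟶ Y i) (g' : U ⟶ Y i')
    (h : g ≫ Sigma.ι Y i = g' ≫ Sigma.ι Y i') :
    ∃ l : U ⟶ single i' U i,
      l ≫ singleDesc (Z := fun _ : I => U) (𝟙 U) i = 𝟙 U ∧ l ≫ singleDesc g' i = g := by
  obtain ⟨l, ⟨h1, h2⟩, -⟩ := exists_unique_lift (singleDesc (Z := Y) g') i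
    (singleι i' U ≫ Sigma.ι (single i' U) i') g (by
      rw [Category.assoc, Sigma.ι_map, reassoc_of% singleι_desc (Z := Y) g', h])
  refine ⟨l, ?_, h2⟩
  have h3 := congrArg
    (fun t => t ≫ Sigma.desc (singleDesc (Z := fun _ : I => U) (i := i') (𝟙 U))) h1
  simp only [Category.assoc, Sigma.ι_desc] at h3
  rw [h3]
  exact singleι_desc (Z := fun _ : I => U) (𝟙 U)

/-- Coproduct inclusions are monomorphisms. -/
theorem ι_cancel {Y : I → V} {U : V} {i : I} {g g' : U ⟶ Y i}
    (h : g ≫ Sigma.ι Y i = g' ≫ Sigma.ι Y i) : g = g' := by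
  obtain ⟨l, h1, h2⟩ := single_retract g g' h
  have e : singleDesc (Z := fun _ : I => U) (𝟙 U) i ≫ singleι i U = 𝟙 (single i U i) := by
    apply Sigma.hom_ext
    rintro ⟨⟨e⟩⟩
    have := singleι_desc (Z := fun _ : I => U) (i := i) (𝟙 U)
    change singleι i U ≫ singleDesc (Z := fun _ : I => U) (𝟙 U) i ≫ _ = singleι i U ≫ 𝟙 _
    rw [reassoc_of% this, Category.comp_id]
  have hl : l = singleι i U := by
    rw [← Category.comp_id l, ← e, reassoc_of% h1]
  rw [← h2, hl, singleι_desc]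

/-- Distinct coproduct inclusions are disjoint. -/
theorem isInitial_of_ne {Y : I → V} {U : V} {i i' : I} (hi : i ≠ i') (g : U ⟶ Y i)
    (g' : U ⟶ Y i') (h : g ≫ Sigma.ι Y i = g' ≫ Sigma.ι Y i') : Nonempty (IsInitial U) := by
  obtain ⟨l, h1, -⟩ := single_retract g g' h
  refine ⟨IsInitial.ofUniqueHom
    (fun Z => l ≫ Sigma.desc fun t => absurd t.down.down.symm hi) fun Z m => ?_⟩
  rw [← Category.id_comp m, ← h1, Category.assoc]
  congr 1
  apply Sigma.hom_ext
  rintro ⟨⟨e⟩⟩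
  exact absurd e.symm hi

end Extensive

end Coproducts

section Internal

attribute [local simp] pullback.lift_fst pullback.lift_snd pullback.lift_fst_assoc
  pullback.lift_snd_assoc

/-- Internal categories in a category with pullbacks. The composite of the universal pair of
composable morphisms is written in diagrammatic order: on generalized elements `f : a ⟶ b`,
`g : b ⟶ c`, the map `comp` returns `f ≫ g : a ⟶ c`. -/
structure InternalCat (V : Type u) [Category.{v} V] [HasPullbacks V] where
  /-- object of objects -/
  Obj : V
  /-- object of morphisms -/
  Mor : V
  src : Mor ⟶ Obj
  tgt : Mor ⟶ Obj
  idt : Obj ⟶ Mor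
  comp : pullback tgt src ⟶ Mor
  idt_src : idt ≫ src = 𝟙 Obj
  idt_tgt : idt ≫ tgt = 𝟙 Obj
  comp_src : comp ≫ src = pullback.fst tgt src ≫ src
  comp_tgt : comp ≫ tgt = pullback.snd tgt src ≫ tgt
  id_comp : pullback.lift (src ≫ idt) (𝟙 Mor) (by simp [idt_tgt]) ≫ comp = 𝟙 Mor
  comp_id : pullback.lift (𝟙 Mor) (tgt ≫ idt) (by simp [idt_src]) ≫ comp = 𝟙 Mor
  /-- Associativity, on all generalized elements of the object of composable triples
  (equivalently, by Yoneda, on the object of composable triples itself). -/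
  assoc : ∀ {X : V} (f g h : X ⟶ Mor) (hfg : f ≫ tgt = g ≫ src) (hgh : g ≫ tgt = h ≫ src),
    pullback.lift (pullback.lift f g hfg ≫ comp) h
        (by rw [Category.assoc, comp_tgt, pullback.lift_snd_assoc, hgh]) ≫ comp =
      pullback.lift f (pullback.lift g h hgh ≫ comp)
        (by rw [Category.assoc, comp_src, pullback.lift_fst_assoc, hfg]) ≫ comp

variable {V : Type u} [Category.{v} V] [HasPullbacks V]

namespace InternalCat

attribute [simp] idt_src idt_tgt comp_src comp_tgt

section

variable (A : InternalCat V) {Z : V} (z : A.Obj ⟶ Z)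

@[simp]
theorem idt_src_assoc : A.idt ≫ A.src ≫ z = z := by
  rw [← Category.assoc, idt_src, Category.id_comp]

@[simp]
theorem idt_tgt_assoc : A.idt ≫ A.tgt ≫ z = z := by
  rw [← Category.assoc, idt_tgt, Category.id_comp]

@[simp]
theorem comp_src_assoc : A.comp ≫ A.src ≫ z = pullback.fst A.tgt A.src ≫ A.src ≫ z := by
  rw [← Category.assoc, comp_src, Category.assoc]

@[simp]
theorem comp_tgt_assoc : A.comp ≫ A.tgt ≫ z = pullback.snd A.tgt A.src ≫ A.tgt ≫ z := by
  rw [← Category.assoc, comp_tgt, Category.assoc]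

end

/-- The composite of two composable generalized elements of the object of morphisms. -/
def mcomp (A : InternalCat V) {X : V} (f g : X ⟶ A.Mor) (h : f ≫ A.tgt = g ≫ A.src) : X ⟶ A.Mor :=
  pullback.lift f g h ≫ A.comp

section

variable (A : InternalCat V) {X Y : V}

@[simp]
theorem mcomp_src (f g : X ⟶ A.Mor) (h : f ≫ A.tgt = g ≫ A.src) :
    A.mcomp f g h ≫ A.src = f ≫ A.src := by simp [mcomp]

@[simp]
theorem mcomp_src_assoc (f g : X ⟶ A.Mor) (h : f ≫ A.tgt = g ≫ A.src) {Z : V} (z : _ ⟶ Z) :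
    A.mcomp f g h ≫ A.src ≫ z =
      f ≫ A.src ≫ z := by
  rw [← Category.assoc, mcomp_src]
  try simp only [Category.assoc]


@[simp]
theorem mcomp_tgt (f g : X ⟶ A.Mor) (h : f ≫ A.tgt = g ≫ A.src) :
    A.mcomp f g h ≫ A.tgt = g ≫ A.tgt := by simp [mcomp]

@[simp]
theorem mcomp_tgt_assoc (f g : X ⟶ A.Mor) (h : f ≫ A.tgt = g ≫ A.src) {Z : V} (z : _ ⟶ Z) :
    A.mcomp f g h ≫ A.tgt ≫ z =
      g ≫ A.tgt ≫ z := by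
  rw [← Category.assoc, mcomp_tgt]
  try simp only [Category.assoc]


@[simp]
theorem comp_mcomp (k : Y ⟶ X) (f g : X ⟶ A.Mor) (h : f ≫ A.tgt = g ≫ A.src) :
    k ≫ A.mcomp f g h = A.mcomp (k ≫ f) (k ≫ g) (by simp [h]) := by
  unfold mcomp
  rw [← Category.assoc]
  congr 1
  apply pullback.hom_ext <;> simp

theorem mcomp_congr {f f' g g' : X ⟶ A.Mor} (hf : f = f') (hg : g = g')
    (h : f ≫ A.tgt = g ≫ A.src) : A.mcomp f g h = A.mcomp f' g' (by rw [← hf, ← hg, h]) := by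
  subst hf hg
  rfl

theorem mcomp_id (f : X ⟶ A.Mor) {a : X ⟶ A.Obj} (h : f ≫ A.tgt = (a ≫ A.idt) ≫ A.src) :
    A.mcomp f (a ≫ A.idt) h = f := by
  obtain rfl : f ≫ A.tgt = a := by simpa using h
  have := congrArg (fun t => f ≫ t) A.comp_id
  simp only [Category.comp_id] at this
  conv_rhs => rw [← this]
  unfold mcomp
  rw [← Category.assoc]
  congr 1
  apply pullback.hom_ext <;> simp

theorem id_mcomp (f : X ⟶ A.Mor) {a : X ⟶ A.Obj} (h : (a ≫ A.idt) ≫ A.tgt = f ≫ A.src) :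
    A.mcomp (a ≫ A.idt) f h = f := by
  obtain rfl : a = f ≫ A.src := by simpa using h
  have := congrArg (fun t => f ≫ t) A.id_comp
  simp only [Category.comp_id] at this
  conv_rhs => rw [← this]
  unfold mcomp
  rw [← Category.assoc]
  congr 1
  apply pullback.hom_ext <;> simp

theorem mcomp_assoc (f g h : X ⟶ A.Mor) (hfg : f ≫ A.tgt = g ≫ A.src)
    (hgh : g ≫ A.tgt = h ≫ A.src) :
    A.mcomp (A.mcomp f g hfg) h (by simpa using hgh) =
      A.mcomp f (A.mcomp g h hgh) (by simpa using hfg) :=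
  A.assoc f g h hfg hgh

end

/-- Internal functors. -/
@[ext]
structure Hom (A B : InternalCat V) where
  obj : A.Obj ⟶ B.Obj
  mor : A.Mor ⟶ B.Mor
  mor_src : mor ≫ B.src = A.src ≫ obj
  mor_tgt : mor ≫ B.tgt = A.tgt ≫ obj
  idt_mor : A.idt ≫ mor = obj ≫ B.idt
  comp_mor : A.comp ≫ mor =
    pullback.lift (pullback.fst A.tgt A.src ≫ mor) (pullback.snd A.tgt A.src ≫ mor)
      (by simp only [Category.assoc, mor_src, mor_tgt, pullback.condition_assoc]) ≫ B.comp

namespace Hom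

attribute [simp] mor_src mor_tgt idt_mor

section

variable {A B : InternalCat V} (F : Hom A B) {Z : V}

@[simp]
theorem mor_src_assoc (z : B.Obj ⟶ Z) : F.mor ≫ B.src ≫ z = A.src ≫ F.obj ≫ z := by
  rw [← Category.assoc, mor_src, Category.assoc]

@[simp]
theorem mor_tgt_assoc (z : B.Obj ⟶ Z) : F.mor ≫ B.tgt ≫ z = A.tgt ≫ F.obj ≫ z := by
  rw [← Category.assoc, mor_tgt, Category.assoc]

@[simp]
theorem idt_mor_assoc (z : B.Mor ⟶ Z) : A.idt ≫ F.mor ≫ z = F.obj ≫ B.idt ≫ z := by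
  rw [← Category.assoc, idt_mor, Category.assoc]

end

@[simp]
theorem mcomp_mor {A B : InternalCat V} (F : Hom A B) {X : V} (f g : X ⟶ A.Mor)
    (h : f ≫ A.tgt = g ≫ A.src) : A.mcomp f g h ≫ F.mor =
      B.mcomp (f ≫ F.mor) (g ≫ F.mor) (by simp [reassoc_of% h]) := by
  unfold mcomp
  rw [Category.assoc, F.comp_mor, ← Category.assoc]
  congr 1
  apply pullback.hom_ext <;> simp

/-- An internal functor from compatibility with composition on generalized elements. -/
theorem comp_mor_of {A B : InternalCat V} (o : A.Mor ⟶ B.Mor)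
    (hh : (pullback.fst A.tgt A.src ≫ o) ≫ B.tgt = (pullback.snd A.tgt A.src ≫ o) ≫ B.src)
    (h : A.mcomp (pullback.fst _ _) (pullback.snd _ _) pullback.condition ≫ o =
      B.mcomp (pullback.fst _ _ ≫ o) (pullback.snd _ _ ≫ o) hh) :
    A.comp ≫ o = pullback.lift (pullback.fst A.tgt A.src ≫ o) (pullback.snd A.tgt A.src ≫ o)
      hh ≫ B.comp := by
  have : pullback.lift (pullback.fst A.tgt A.src) (pullback.snd A.tgt A.src)
      pullback.condition = 𝟙 _ := by apply pullback.hom_ext <;> simp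
  unfold mcomp at h
  rwa [this, Category.id_comp] at h

end Hom

/-- The category of internal categories and internal functors. -/
instance : Category (InternalCat V) where
  Hom := Hom
  id A :=
    { obj := 𝟙 _
      mor := 𝟙 _
      mor_src := by simp
      mor_tgt := by simp
      idt_mor := by simp
      comp_mor := Hom.comp_mor_of _ (by simp [pullback.condition]) (by simp) }
  comp F G :=
    { obj := F.obj ≫ G.obj
      mor := F.mor ≫ G.mor
      mor_src := by simp
      mor_tgt := by simp
      idt_mor := by simp
      comp_mor := Hom.comp_mor_of _ (by simp [pullback.condition_assoc])
        (by simp only [← Category.assoc, Hom.mcomp_mor]) }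
  id_comp F := Hom.ext (Category.id_comp _) (Category.id_comp _)
  comp_id F := Hom.ext (Category.comp_id _) (Category.comp_id _)
  assoc F G H := Hom.ext (Category.assoc _ _ _) (Category.assoc _ _ _)

@[ext]
theorem hom_ext {A B : InternalCat V} {F G : A ⟶ B} (h₀ : F.obj = G.obj) (h₁ : F.mor = G.mor) :
    F = G := Hom.ext h₀ h₁

@[simp] theorem id_obj (A : InternalCat V) : Hom.obj (𝟙 A) = 𝟙 _ := rfl
@[simp] theorem id_mor (A : InternalCat V) : Hom.mor (𝟙 A) = 𝟙 _ := rfl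
@[simp] theorem comp_obj {A B C : InternalCat V} (F : A ⟶ B) (G : B ⟶ C) :
    Hom.obj (F ≫ G) = F.obj ≫ G.obj := rfl
@[simp] theorem comp_mor {A B C : InternalCat V} (F : A ⟶ B) (G : B ⟶ C) :
    Hom.mor (F ≫ G) = F.mor ≫ G.mor := rfl

/-- The constant internal category at `X`. -/
def cst (X : V) : InternalCat V where
  Obj := X
  Mor := X
  src := 𝟙 X
  tgt := 𝟙 X
  idt := 𝟙 X
  comp := pullback.fst _ _
  idt_src := by simp
  idt_tgt := by simp
  comp_src := by simp
  comp_tgt := pullback.condition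
  id_comp := by simp
  comp_id := by simp
  assoc f g h hfg hgh := by
    simp only [Category.comp_id] at hfg
    simp [hfg]

/-- The internal functor `cst X ⟶ A` with the given action on objects. -/
def cstHom {A : InternalCat V} {X : V} (a : X ⟶ A.Obj) : cst X ⟶ A where
  obj := a
  mor := a ≫ A.idt
  mor_src := by simp [cst]
  mor_tgt := by simp [cst]
  idt_mor := by simp [cst]
  comp_mor := by
    have e : pullback.fst (𝟙 X) (𝟙 X) = pullback.snd (𝟙 X) (𝟙 X) := by
      simpa using pullback.condition (f := 𝟙 X) (g := 𝟙 X)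
    have h : (pullback.fst (𝟙 X) (𝟙 X) ≫ a ≫ A.idt) ≫ A.tgt =
        ((pullback.snd (𝟙 X) (𝟙 X) ≫ a) ≫ A.idt) ≫ A.src := by simp [e]
    have := A.mcomp_id _ h
    unfold mcomp at this
    simp only [Category.assoc] at this
    exact this.symm

section Arrow

variable (A : InternalCat V)

/-- The object of commutative squares of `A`: a square
```
  a --top--> b
  |left      |right
  a' --bot-> b'
```
is presented by the composable pairs `(top, right)` and `(left, bot)` with equal composites. -/
abbrev Sq : V := pullback A.comp A.comp

def sqTop : A.Sq ⟶ A.Mor := pullback.fst A.comp A.comp ≫ pullback.fst A.tgt A.src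
def sqRight : A.Sq ⟶ A.Mor := pullback.fst A.comp A.comp ≫ pullback.snd A.tgt A.src
def sqLeft : A.Sq ⟶ A.Mor := pullback.snd A.comp A.comp ≫ pullback.fst A.tgt A.src
def sqBot : A.Sq ⟶ A.Mor := pullback.snd A.comp A.comp ≫ pullback.snd A.tgt A.src

@[simp]
theorem sqTop_tgt : A.sqTop ≫ A.tgt = A.sqRight ≫ A.src := by
  simp only [sqTop, sqRight, Category.assoc, pullback.condition]

@[simp]
theorem sqTop_tgt_assoc {Z : V} (z : _ ⟶ Z) :
    A.sqTop ≫ A.tgt ≫ z =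
      A.sqRight ≫ A.src ≫ z := by
  rw [← Category.assoc, sqTop_tgt]
  try simp only [Category.assoc]


@[simp]
theorem sqLeft_tgt : A.sqLeft ≫ A.tgt = A.sqBot ≫ A.src := by
  simp only [sqLeft, sqBot, Category.assoc, pullback.condition]

@[simp]
theorem sqLeft_tgt_assoc {Z : V} (z : _ ⟶ Z) :
    A.sqLeft ≫ A.tgt ≫ z =
      A.sqBot ≫ A.src ≫ z := by
  rw [← Category.assoc, sqLeft_tgt]
  try simp only [Category.assoc]


theorem sq_comm : A.mcomp A.sqTop A.sqRight A.sqTop_tgt =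
    A.mcomp A.sqLeft A.sqBot A.sqLeft_tgt := by
  have h1 : pullback.lift A.sqTop A.sqRight A.sqTop_tgt = pullback.fst A.comp A.comp := by
    apply pullback.hom_ext <;> simp [sqTop, sqRight]
  have h2 : pullback.lift A.sqLeft A.sqBot A.sqLeft_tgt = pullback.snd A.comp A.comp := by
    apply pullback.hom_ext <;> simp [sqLeft, sqBot]
  rw [mcomp, mcomp, h1, h2, pullback.condition]

@[simp]
theorem sqTop_src : A.sqTop ≫ A.src = A.sqLeft ≫ A.src := by
  have := congrArg (fun t => t ≫ A.src) A.sq_comm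
  simpa using this

@[simp]
theorem sqTop_src_assoc {Z : V} (z : _ ⟶ Z) :
    A.sqTop ≫ A.src ≫ z =
      A.sqLeft ≫ A.src ≫ z := by
  rw [← Category.assoc, sqTop_src]
  try simp only [Category.assoc]


@[simp]
theorem sqRight_tgt : A.sqRight ≫ A.tgt = A.sqBot ≫ A.tgt := by
  have := congrArg (fun t => t ≫ A.tgt) A.sq_comm
  simpa using this

@[simp]
theorem sqRight_tgt_assoc {Z : V} (z : _ ⟶ Z) :
    A.sqRight ≫ A.tgt ≫ z =
      A.sqBot ≫ A.tgt ≫ z := by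
  rw [← Category.assoc, sqRight_tgt]
  try simp only [Category.assoc]


variable {A} {X : V}

/-- The generalized commutative square with given sides. -/
def sqLift (f v u f' : X ⟶ A.Mor) (h : f ≫ A.tgt = v ≫ A.src) (h' : u ≫ A.tgt = f' ≫ A.src)
    (e : A.mcomp f v h = A.mcomp u f' h') : X ⟶ A.Sq :=
  pullback.lift (pullback.lift f v h) (pullback.lift u f' h') e

section

variable (f v u f' : X ⟶ A.Mor) (h : f ≫ A.tgt = v ≫ A.src) (h' : u ≫ A.tgt = f' ≫ A.src)
    (e : A.mcomp f v h = A.mcomp u f' h')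

@[simp]
theorem sqLift_top : sqLift f v u f' h h' e ≫ A.sqTop = f :=
  (pullback.lift_fst_assoc _ _ e _).trans (pullback.lift_fst _ _ _)

@[simp]
theorem sqLift_top_assoc {Z : V} (z : _ ⟶ Z) :
    sqLift f v u f' h h' e ≫ A.sqTop ≫ z =
      f ≫ z := by
  rw [← Category.assoc, sqLift_top]
  try simp only [Category.assoc]

@[simp]
theorem sqLift_right : sqLift f v u f' h h' e ≫ A.sqRight = v :=
  (pullback.lift_fst_assoc _ _ e _).trans (pullback.lift_snd _ _ _)

@[simp]
theorem sqLift_right_assoc {Z : V} (z : _ ⟶ Z) :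
    sqLift f v u f' h h' e ≫ A.sqRight ≫ z =
      v ≫ z := by
  rw [← Category.assoc, sqLift_right]
  try simp only [Category.assoc]

@[simp]
theorem sqLift_left : sqLift f v u f' h h' e ≫ A.sqLeft = u :=
  (pullback.lift_snd_assoc _ _ e _).trans (pullback.lift_fst _ _ _)

@[simp]
theorem sqLift_left_assoc {Z : V} (z : _ ⟶ Z) :
    sqLift f v u f' h h' e ≫ A.sqLeft ≫ z =
      u ≫ z := by
  rw [← Category.assoc, sqLift_left]
  try simp only [Category.assoc]

@[simp]
theorem sqLift_bot : sqLift f v u f' h h' e ≫ A.sqBot = f' :=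
  (pullback.lift_snd_assoc _ _ e _).trans (pullback.lift_snd _ _ _)

@[simp]
theorem sqLift_bot_assoc {Z : V} (z : _ ⟶ Z) :
    sqLift f v u f' h h' e ≫ A.sqBot ≫ z =
      f' ≫ z := by
  rw [← Category.assoc, sqLift_bot]
  try simp only [Category.assoc]


end

theorem sq_hom_ext {σ τ : X ⟶ A.Sq} (h₁ : σ ≫ A.sqTop = τ ≫ A.sqTop)
    (h₂ : σ ≫ A.sqRight = τ ≫ A.sqRight) (h₃ : σ ≫ A.sqLeft = τ ≫ A.sqLeft)
    (h₄ : σ ≫ A.sqBot = τ ≫ A.sqBot) : σ = τ := by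
  apply pullback.hom_ext <;> apply pullback.hom_ext
  · simpa [sqTop] using h₁
  · simpa [sqRight] using h₂
  · simpa [sqLeft] using h₃
  · simpa [sqBot] using h₄

theorem sq_comm' (σ : X ⟶ A.Sq) :
    A.mcomp (σ ≫ A.sqTop) (σ ≫ A.sqRight) (by simp) =
      A.mcomp (σ ≫ A.sqLeft) (σ ≫ A.sqBot) (by simp) := by
  simpa using congrArg (fun t => σ ≫ t) A.sq_comm

theorem paste_aux {σ τ : X ⟶ A.Sq} (h : σ ≫ A.sqBot = τ ≫ A.sqTop) :
    (σ ≫ A.sqRight) ≫ A.tgt = (τ ≫ A.sqRight) ≫ A.src := by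
  rw [Category.assoc, sqRight_tgt, reassoc_of% h, sqTop_tgt, Category.assoc]

/-- Vertical pasting of squares. -/
def sqPaste (σ τ : X ⟶ A.Sq) (h : σ ≫ A.sqBot = τ ≫ A.sqTop) : X ⟶ A.Sq :=
  sqLift (σ ≫ A.sqTop)
    (A.mcomp (σ ≫ A.sqRight) (τ ≫ A.sqRight) (paste_aux h))
    (A.mcomp (σ ≫ A.sqLeft) (τ ≫ A.sqLeft) (by simp [reassoc_of% h]))
    (τ ≫ A.sqBot) (by simp) (by simp) (by
      have h1 := paste_aux h
      have h2 : (σ ≫ A.sqLeft) ≫ A.tgt = (τ ≫ A.sqLeft) ≫ A.src := by simp [reassoc_of% h]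
      have h3 : (σ ≫ A.sqTop) ≫ A.tgt = (σ ≫ A.sqRight) ≫ A.src := by simp
      have h4 : (τ ≫ A.sqLeft) ≫ A.tgt = (τ ≫ A.sqBot) ≫ A.src := by simp
      have h5 : (σ ≫ A.sqLeft) ≫ A.tgt = (σ ≫ A.sqBot) ≫ A.src := by simp
      have h6 : (σ ≫ A.sqBot) ≫ A.tgt = (τ ≫ A.sqRight) ≫ A.src := by simp [reassoc_of% h]
      rw [← mcomp_assoc _ _ _ _ h3 h1, mcomp_assoc _ _ _ _ h2 h4,
        A.mcomp_congr (sq_comm' σ) rfl, mcomp_assoc _ _ _ _ h5 h6,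
        A.mcomp_congr rfl (sq_comm' τ).symm]
      exact A.mcomp_congr rfl (A.mcomp_congr h rfl _) _)

variable (A) in
/-- The internal category `⟦𝟚, A⟧` of arrows of `A`: its object of objects is the object of
morphisms of `A`, its object of morphisms is the object of commutative squares of `A`, a square
being a morphism from its top side to its bottom side, and composition pastes squares. -/
def arrow : InternalCat V where
  Obj := A.Mor
  Mor := A.Sq
  src := A.sqTop
  tgt := A.sqBot
  idt := sqLift (𝟙 _) (A.tgt ≫ A.idt) (A.src ≫ A.idt) (𝟙 _) (by simp) (by simp)
    (by rw [A.mcomp_id, A.id_mcomp])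
  comp := sqPaste (pullback.fst _ _) (pullback.snd _ _) pullback.condition
  idt_src := by simp
  idt_tgt := by simp
  comp_src := by simp [sqPaste]
  comp_tgt := by simp [sqPaste]
  id_comp := by
    apply sq_hom_ext
    · simp [sqPaste]
    · simpa [sqPaste] using A.id_mcomp A.sqRight (a := A.sqRight ≫ A.src) (by simp)
    · simpa [sqPaste] using A.id_mcomp A.sqLeft (a := A.sqLeft ≫ A.src) (by simp)
    · simp [sqPaste]
  comp_id := by
    apply sq_hom_ext
    · simp [sqPaste]
    · simpa [sqPaste] using A.mcomp_id A.sqRight (a := A.sqRight ≫ A.tgt) (by simp)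
    · simpa [sqPaste] using A.mcomp_id A.sqLeft (a := A.sqLeft ≫ A.tgt) (by simp)
    · simp [sqPaste]
  assoc f g h hfg hgh := by
    apply sq_hom_ext
    · simp [sqPaste]
    · simpa [sqPaste] using mcomp_assoc _ _ _ _ _ _
    · simpa [sqPaste] using mcomp_assoc _ _ _ _ _ _
    · simp [sqPaste]

@[simp] theorem arrow_mor (A : InternalCat V) : (arrow A).Mor = A.Sq := rfl

@[simp]
theorem arrow_mcomp {f g : X ⟶ A.Sq} (h : f ≫ A.sqBot = g ≫ A.sqTop) :
    (arrow A).mcomp f g h = sqPaste f g h := by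
  apply sq_hom_ext
  all_goals
    refine Eq.trans (b := (pullback.lift f g h ≫ sqPaste (pullback.fst _ _) (pullback.snd _ _)
      pullback.condition) ≫ _) rfl ?_
    simp [sqPaste]

variable (A)

/-- The internal functor `⟨0⟩^* : ⟦𝟚, A⟧ ⟶ A` sending an arrow to its source. -/
def arrowDom : arrow A ⟶ A where
  obj := A.src
  mor := A.sqLeft
  mor_src := A.sqTop_src.symm
  mor_tgt := A.sqLeft_tgt
  idt_mor := sqLift_left _ _ _ _ _ _ _
  comp_mor := sqLift_left _ _ _ _ _ _ _

/-- The internal functor `⟨1⟩^* : ⟦𝟚, A⟧ ⟶ A` sending an arrow to its target. -/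
def arrowCod : arrow A ⟶ A where
  obj := A.tgt
  mor := A.sqRight
  mor_src := A.sqTop_tgt.symm
  mor_tgt := A.sqRight_tgt
  idt_mor := sqLift_right _ _ _ _ _ _ _
  comp_mor := sqLift_right _ _ _ _ _ _ _

end Arrow

section Limits

variable {A B C : InternalCat V} (F : A ⟶ C) (G : B ⟶ C)

section

variable {X : V} (f g : X ⟶ pullback F.mor G.mor)
  (h : f ≫ pullback.fst F.mor G.mor ≫ A.tgt = g ≫ pullback.fst F.mor G.mor ≫ A.src)
  (h' : f ≫ pullback.snd F.mor G.mor ≫ B.tgt = g ≫ pullback.snd F.mor G.mor ≫ B.src)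

/-- Componentwise composition of compatible pairs of morphisms. -/
def pbComp : X ⟶ pullback F.mor G.mor :=
  pullback.lift
    (A.mcomp (f ≫ pullback.fst _ _) (g ≫ pullback.fst _ _) (by simpa using h))
    (B.mcomp (f ≫ pullback.snd _ _) (g ≫ pullback.snd _ _) (by simpa using h'))
    (by
      rw [Hom.mcomp_mor, Hom.mcomp_mor]
      apply mcomp_congr <;> simp [pullback.condition])

@[simp]
theorem pbComp_fst : pbComp F G f g h h' ≫ pullback.fst _ _ =
    A.mcomp (f ≫ pullback.fst _ _) (g ≫ pullback.fst _ _) (by simpa using h) :=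
  pullback.lift_fst _ _ _

@[simp]
theorem pbComp_fst_assoc {Z : V} (z : _ ⟶ Z) :
    pbComp F G f g h h' ≫ pullback.fst _ _ ≫ z =
      A.mcomp (f ≫ pullback.fst _ _) (g ≫ pullback.fst _ _) (by simpa using h) ≫ z := by
  rw [← Category.assoc, pbComp_fst]
  try simp only [Category.assoc]


@[simp]
theorem pbComp_snd : pbComp F G f g h h' ≫ pullback.snd _ _ =
    B.mcomp (f ≫ pullback.snd _ _) (g ≫ pullback.snd _ _) (by simpa using h') :=
  pullback.lift_snd _ _ _

@[simp]
theorem pbComp_snd_assoc {Z : V} (z : _ ⟶ Z) :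
    pbComp F G f g h h' ≫ pullback.snd _ _ ≫ z =
      B.mcomp (f ≫ pullback.snd _ _) (g ≫ pullback.snd _ _) (by simpa using h') ≫ z := by
  rw [← Category.assoc, pbComp_snd]
  try simp only [Category.assoc]


end

def pbSrc : pullback F.mor G.mor ⟶ pullback F.obj G.obj :=
  pullback.lift (pullback.fst _ _ ≫ A.src) (pullback.snd _ _ ≫ B.src) (by
    rw [Category.assoc, Category.assoc, ← F.mor_src, ← G.mor_src, pullback.condition_assoc])

def pbTgt : pullback F.mor G.mor ⟶ pullback F.obj G.obj :=
  pullback.lift (pullback.fst _ _ ≫ A.tgt) (pullback.snd _ _ ≫ B.tgt) (by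
    rw [Category.assoc, Category.assoc, ← F.mor_tgt, ← G.mor_tgt, pullback.condition_assoc])

@[simp]
theorem pbSrc_fst : pbSrc F G ≫ pullback.fst _ _ = pullback.fst _ _ ≫ A.src :=
  pullback.lift_fst _ _ _

@[simp]
theorem pbSrc_fst_assoc {Z : V} (z : _ ⟶ Z) :
    pbSrc F G ≫ pullback.fst _ _ ≫ z =
      pullback.fst _ _ ≫ A.src ≫ z := by
  rw [← Category.assoc, pbSrc_fst]
  try simp only [Category.assoc]

@[simp]
theorem pbSrc_snd : pbSrc F G ≫ pullback.snd _ _ = pullback.snd _ _ ≫ B.src :=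
  pullback.lift_snd _ _ _

@[simp]
theorem pbSrc_snd_assoc {Z : V} (z : _ ⟶ Z) :
    pbSrc F G ≫ pullback.snd _ _ ≫ z =
      pullback.snd _ _ ≫ B.src ≫ z := by
  rw [← Category.assoc, pbSrc_snd]
  try simp only [Category.assoc]

@[simp]
theorem pbTgt_fst : pbTgt F G ≫ pullback.fst _ _ = pullback.fst _ _ ≫ A.tgt :=
  pullback.lift_fst _ _ _

@[simp]
theorem pbTgt_fst_assoc {Z : V} (z : _ ⟶ Z) :
    pbTgt F G ≫ pullback.fst _ _ ≫ z =
      pullback.fst _ _ ≫ A.tgt ≫ z := by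
  rw [← Category.assoc, pbTgt_fst]
  try simp only [Category.assoc]

@[simp]
theorem pbTgt_snd : pbTgt F G ≫ pullback.snd _ _ = pullback.snd _ _ ≫ B.tgt :=
  pullback.lift_snd _ _ _

@[simp]
theorem pbTgt_snd_assoc {Z : V} (z : _ ⟶ Z) :
    pbTgt F G ≫ pullback.snd _ _ ≫ z =
      pullback.snd _ _ ≫ B.tgt ≫ z := by
  rw [← Category.assoc, pbTgt_snd]
  try simp only [Category.assoc]


theorem pb_aux₁ {X : V} {f g : X ⟶ pullback F.mor G.mor} (h : f ≫ pbTgt F G = g ≫ pbSrc F G) :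
    f ≫ pullback.fst F.mor G.mor ≫ A.tgt = g ≫ pullback.fst F.mor G.mor ≫ A.src := by
  simpa using h =≫ pullback.fst _ _

theorem pb_aux₂ {X : V} {f g : X ⟶ pullback F.mor G.mor} (h : f ≫ pbTgt F G = g ≫ pbSrc F G) :
    f ≫ pullback.snd F.mor G.mor ≫ B.tgt = g ≫ pullback.snd F.mor G.mor ≫ B.src := by
  simpa using h =≫ pullback.snd _ _

/-- The levelwise pullback of internal categories. -/
def pb : InternalCat V where
  Obj := pullback F.obj G.obj
  Mor := pullback F.mor G.mor
  src := pbSrc F G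
  tgt := pbTgt F G
  idt := pullback.lift (pullback.fst _ _ ≫ A.idt) (pullback.snd _ _ ≫ B.idt) (by
    rw [Category.assoc, Category.assoc, F.idt_mor, G.idt_mor, pullback.condition_assoc])
  comp := pbComp F G (pullback.fst _ _) (pullback.snd _ _)
    (pb_aux₁ F G pullback.condition) (pb_aux₂ F G pullback.condition)
  idt_src := by apply pullback.hom_ext <;> simp
  idt_tgt := by apply pullback.hom_ext <;> simp
  comp_src := by apply pullback.hom_ext <;> simp
  comp_tgt := by apply pullback.hom_ext <;> simp
  id_comp := by
    apply pullback.hom_ext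
    · simpa using A.id_mcomp (pullback.fst F.mor G.mor) (a := pullback.fst F.mor G.mor ≫ A.src)
        (by simp)
    · simpa using B.id_mcomp (pullback.snd F.mor G.mor) (a := pullback.snd F.mor G.mor ≫ B.src)
        (by simp)
  comp_id := by
    apply pullback.hom_ext
    · simpa using A.mcomp_id (pullback.fst F.mor G.mor) (a := pullback.fst F.mor G.mor ≫ A.tgt)
        (by simp)
    · simpa using B.mcomp_id (pullback.snd F.mor G.mor) (a := pullback.snd F.mor G.mor ≫ B.tgt)
        (by simp)
  assoc f g h hfg hgh := by
    have h1 := pb_aux₁ F G hfg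
    have h2 := pb_aux₂ F G hfg
    have h3 := pb_aux₁ F G hgh
    have h4 := pb_aux₂ F G hgh
    apply pullback.hom_ext
    · simpa using mcomp_assoc A (f ≫ pullback.fst _ _) (g ≫ pullback.fst _ _)
        (h ≫ pullback.fst _ _) (by simpa using h1) (by simpa using h3)
    · simpa using mcomp_assoc B (f ≫ pullback.snd _ _) (g ≫ pullback.snd _ _)
        (h ≫ pullback.snd _ _) (by simpa using h2) (by simpa using h4)

def pbFst : pb F G ⟶ A where
  obj := pullback.fst _ _
  mor := pullback.fst _ _
  mor_src := (pullback.lift_fst _ _ _).symm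
  mor_tgt := (pullback.lift_fst _ _ _).symm
  idt_mor := pullback.lift_fst _ _ _
  comp_mor := pullback.lift_fst _ _ _

def pbSnd : pb F G ⟶ B where
  obj := pullback.snd _ _
  mor := pullback.snd _ _
  mor_src := (pullback.lift_snd _ _ _).symm
  mor_tgt := (pullback.lift_snd _ _ _).symm
  idt_mor := pullback.lift_snd _ _ _
  comp_mor := pullback.lift_snd _ _ _

theorem pb_condition : pbFst F G ≫ F = pbSnd F G ≫ G :=
  hom_ext pullback.condition pullback.condition

variable {F G} in
def pbLift {D : InternalCat V} (H : D ⟶ A) (K : D ⟶ B) (e : H ≫ F = K ≫ G) : D ⟶ pb F G where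
  obj := pullback.lift H.obj K.obj (congrArg Hom.obj e)
  mor := pullback.lift H.mor K.mor (congrArg Hom.mor e)
  mor_src := by apply pullback.hom_ext <;> simp [pb]
  mor_tgt := by apply pullback.hom_ext <;> simp [pb]
  idt_mor := by apply pullback.hom_ext <;> simp [pb]
  comp_mor := by
    have hh : (pullback.fst D.tgt D.src ≫ pullback.lift H.mor K.mor (congrArg Hom.mor e)) ≫
        (pb F G).tgt = (pullback.snd D.tgt D.src ≫
          pullback.lift H.mor K.mor (congrArg Hom.mor e)) ≫ (pb F G).src := by
      apply pullback.hom_ext <;> simp [pb, pullback.condition_assoc]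
    refine Hom.comp_mor_of (B := pb F G) _ hh ?_
    · apply pullback.hom_ext
      · refine Eq.trans ?_ (Hom.mcomp_mor (pbFst F G) _ _ _).symm
        have e' : ∀ {X : V} (k : X ⟶ D.Mor),
            (k ≫ pullback.lift H.mor K.mor (congrArg Hom.mor e)) ≫ pullback.fst F.mor G.mor =
              k ≫ H.mor := fun k => by rw [Category.assoc, pullback.lift_fst]
        exact (e' _).trans ((Hom.mcomp_mor H _ _ _).trans
          (mcomp_congr _ (e' _).symm (e' _).symm _))
      · refine Eq.trans ?_ (Hom.mcomp_mor (pbSnd F G) _ _ _).symm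
        have e' : ∀ {X : V} (k : X ⟶ D.Mor),
            (k ≫ pullback.lift H.mor K.mor (congrArg Hom.mor e)) ≫ pullback.snd F.mor G.mor =
              k ≫ K.mor := fun k => by rw [Category.assoc, pullback.lift_snd]
        exact (e' _).trans ((Hom.mcomp_mor K _ _ _).trans
          (mcomp_congr _ (e' _).symm (e' _).symm _))

theorem isPullback_pb : IsPullback (pbFst F G) (pbSnd F G) F G :=
  ⟨⟨pb_condition F G⟩, ⟨PullbackCone.IsLimit.mk _
    (fun s => pbLift s.fst s.snd s.condition)
    (fun s => hom_ext (pullback.lift_fst _ _ _) (pullback.lift_fst _ _ _))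
    (fun s => hom_ext (pullback.lift_snd _ _ _) (pullback.lift_snd _ _ _))
    (fun s m h₁ h₂ => by
      apply hom_ext
      · apply pullback.hom_ext
        · exact (congrArg Hom.obj h₁).trans (pullback.lift_fst _ _ _).symm
        · exact (congrArg Hom.obj h₂).trans (pullback.lift_snd _ _ _).symm
      · apply pullback.hom_ext
        · exact (congrArg Hom.mor h₁).trans (pullback.lift_fst _ _ _).symm
        · exact (congrArg Hom.mor h₂).trans (pullback.lift_snd _ _ _).symm)⟩⟩

instance : HasPullbacks (InternalCat V) :=
  have : ∀ {X Y Z : InternalCat V} {f : X ⟶ Z} {g : Y ⟶ Z}, HasLimit (cospan f g) :=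
    fun {_ _ _ f g} => (isPullback_pb f g).hasPullback
  hasPullbacks_of_hasLimit_cospan _

end Limits

section Terminal

variable [CartesianMonoidalCategory V]

/-- `cst *` is a terminal object of the category of internal categories. -/
def cstUnitIsTerminal : IsTerminal (cst (𝟙_ V)) :=
  IsTerminal.ofUniqueHom
    (fun _ =>
      { obj := toUnit _
        mor := toUnit _
        mor_src := toUnit_unique _ _
        mor_tgt := toUnit_unique _ _
        idt_mor := toUnit_unique _ _
        comp_mor := toUnit_unique _ _ })
    (fun _ _ => hom_ext (toUnit_unique _ _) (toUnit_unique _ _))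

instance : HasTerminal (InternalCat V) := cstUnitIsTerminal.hasTerminal

instance : HasBinaryProducts (InternalCat V) :=
  hasBinaryProducts_of_hasTerminal_and_pullbacks _

/-- The slice `A / T` of an internal category over an element `T : * ⟶ A`. -/
def slice {A : InternalCat V} (T : cst (𝟙_ V) ⟶ A) : InternalCat V :=
  pullback (prod.lift (𝟙 A) (cstUnitIsTerminal.from A ≫ T)) (prod.lift (arrowDom A) (arrowCod A))

/-- The canonical projection `A / T ⟶ A`. -/
def sliceProj {A : InternalCat V} (T : cst (𝟙_ V) ⟶ A) : slice T ⟶ A :=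
  pullback.fst _ _

/-- `T` is an internal terminal object of `A` if the projection `A / T ⟶ A` is invertible. -/
def IsInternalTerminal {A : InternalCat V} (T : cst (𝟙_ V) ⟶ A) : Prop :=
  IsIso (sliceProj T)

end Terminal

end InternalCat

end Internal

section Presheaf

section

variable {V : Type u} [Category.{v} V] [CartesianMonoidalCategory V] [MonoidalClosed V]

theorem uncurry_tensor_comp {P Q x y z : V} (p : P ⟶ (ihom x).obj y) (q : Q ⟶ (ihom y).obj z) :
    MonoidalClosed.uncurry ((p ⊗ₘ q) ≫ MonoidalClosed.comp x y z) =
      (α_ _ _ _).inv ≫ (MonoidalClosed.uncurry p ▷ Q) ≫ MonoidalClosed.uncurry q := by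
  rw [MonoidalClosed.uncurry_natural_left, MonoidalClosed.comp_eq, MonoidalClosed.uncurry_curry,
    MonoidalClosed.compTranspose_eq, MonoidalClosed.uncurry_eq p, MonoidalClosed.uncurry_eq q,
    MonoidalCategory.tensorHom_def, MonoidalCategory.whiskerLeft_comp,
    MonoidalCategory.comp_whiskerRight]
  simp only [Category.assoc]
  rw [associator_inv_naturality_right_assoc, whisker_exchange_assoc,
    associator_inv_naturality_middle_assoc]
  rfl

variable [BraidedCategory V]

theorem action_comp_iff {P Q R x y z : V} (m : Q ⊗ P ⟶ R) (p : P ⟶ (ihom x).obj y)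
    (q : Q ⟶ (ihom y).obj z) (r : R ⟶ (ihom x).obj z) :
    ((β_ P Q).hom ≫ m) ≫ r = (p ⊗ₘ q) ≫ MonoidalClosed.comp x y z ↔
      (α_ Q P x).hom ≫ Q ◁ ((β_ P x).hom ≫ MonoidalClosed.uncurry p) ≫ (β_ Q y).hom ≫
          MonoidalClosed.uncurry q =
        m ▷ x ≫ (β_ R x).hom ≫ MonoidalClosed.uncurry r := by
  have e1 : (α_ Q P x).hom ≫ Q ◁ ((β_ P x).hom ≫ MonoidalClosed.uncurry p) ≫ (β_ Q y).hom ≫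
      MonoidalClosed.uncurry q = ((β_ (Q ⊗ P) x).hom ≫ x ◁ (β_ Q P).hom) ≫
        MonoidalClosed.uncurry ((p ⊗ₘ q) ≫ MonoidalClosed.comp x y z) := by
    rw [uncurry_tensor_comp, MonoidalCategory.whiskerLeft_comp_assoc,
      BraidedCategory.braiding_naturality_right_assoc]
    simp only [← Category.assoc]
    congr 2
    ext <;> simp
  have e2 : m ▷ x ≫ (β_ R x).hom ≫ MonoidalClosed.uncurry r =
      ((β_ (Q ⊗ P) x).hom ≫ x ◁ (β_ Q P).hom) ≫
        MonoidalClosed.uncurry (((β_ P Q).hom ≫ m) ≫ r) := by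
    rw [MonoidalClosed.uncurry_natural_left, Category.assoc,
      ← MonoidalCategory.whiskerLeft_comp_assoc, SymmetricCategory.symmetry_assoc,
      BraidedCategory.braiding_naturality_left_assoc]
  rw [e1, e2, cancel_epi, MonoidalClosed.uncurry_injective.eq_iff, eq_comm]

theorem action_id_iff {R x : V} (e : 𝟙_ V ⟶ R) (r : R ⟶ (ihom x).obj x) :
    e ≫ r = MonoidalClosed.id x ↔
      lift (toUnit _ ≫ e) (𝟙 x) ≫ (β_ R x).hom ≫ MonoidalClosed.uncurry r = 𝟙 x := by
  have h : lift (toUnit _ ≫ e) (𝟙 x) ≫ (β_ R x).hom = (ρ_ x).inv ≫ x ◁ e := by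
    ext <;> simp
  rw [reassoc_of% h, Iso.inv_comp_eq, Category.comp_id, ← MonoidalClosed.uncurry_natural_left,
    MonoidalClosed.id_eq]
  constructor
  · intro h
    rw [h, MonoidalClosed.uncurry_curry]
  · intro h
    rw [← h, MonoidalClosed.curry_uncurry]

end

variable {V : Type u} [Category.{v} V] [CartesianMonoidalCategory V]
  {C : Type w} [EnrichedCategory V C]

theorem eId_lift_comp (A D : C) :
    lift (toUnit _ ≫ eId V A) (𝟙 (A ⟶[V] D)) ≫ eComp V A A D = 𝟙 _ := by
  have h : lift (toUnit _ ≫ eId V A) (𝟙 (A ⟶[V] D)) = (λ_ _).inv ≫ eId V A ▷ _ := by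
    ext <;> simp
  rw [h, Category.assoc, e_id_comp]

theorem lift_eId_comp {A D : C} {U : V} (f : U ⟶ (A ⟶[V] D)) :
    lift (toUnit _ ≫ eId V A) f ≫ eComp V A A D = f := by
  have h : lift (toUnit _ ≫ eId V A) f = f ≫ (λ_ _).inv ≫ eId V A ▷ _ := by
    ext <;> simp
  rw [h, Category.assoc, Category.assoc, e_id_comp, Category.comp_id]

theorem lift_comp_eId {A D : C} {U : V} (f : U ⟶ (A ⟶[V] D)) :
    lift f (toUnit _ ≫ eId V D) ≫ eComp V A D D = f := by
  have h : lift f (toUnit _ ≫ eId V D) = f ≫ (ρ_ _).inv ≫ _ ◁ eId V D := by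
    ext <;> simp
  rw [h, Category.assoc, Category.assoc, e_comp_id, Category.comp_id]

theorem lift_eComp_assoc {A B D E : C} {U : V} (a : U ⟶ (A ⟶[V] B)) (b : U ⟶ (B ⟶[V] D))
    (c : U ⟶ (D ⟶[V] E)) : lift (lift a b ≫ eComp V A B D) c ≫ eComp V A D E =
      lift a (lift b c ≫ eComp V B D E) ≫ eComp V A B E := by
  have := lift a (lift b c) ≫= e_assoc V A B D E
  rwa [lift_lift_associator_inv_assoc, lift_whiskerRight_assoc, lift_whiskerLeft_assoc] at this

variable [BraidedCategory V] [MonoidalClosed V]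

/-- The action map `C(A, B) ⊗ F B ⟶ F A` of a `V`-functor `F : Cᵒᵖ ⥤ V`, i.e. the transpose of
`F_{A, B} : C(A, B) ⟶ [F B, F A]`. -/
def ev (F : EnrichedFunctor V Cᵒᵖ V) (A B : C) :
    (A ⟶[V] B) ⊗ F.obj (op B) ⟶ F.obj (op A) :=
  (β_ _ _).hom ≫ MonoidalClosed.uncurry (F.map (op B) (op A))

theorem ev_id (F : EnrichedFunctor V Cᵒᵖ V) (A : C) :
    lift (toUnit _ ≫ eId V A) (𝟙 (F.obj (op A))) ≫ ev F A A = 𝟙 _ :=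
  (action_id_iff _ _).1 (F.map_id (op A))

theorem ev_comp (F : EnrichedFunctor V Cᵒᵖ V) (A B D : C) :
    (α_ _ _ _).hom ≫ ((A ⟶[V] B) ◁ ev F B D) ≫ ev F A B =
      (eComp V A B D ▷ F.obj (op D)) ≫ ev F A D :=
  (action_comp_iff (eComp V A B D) (F.map (op D) (op B)) (F.map (op B) (op A))
    (F.map (op D) (op A))).1 (F.map_comp (op D) (op B) (op A))

theorem lift_eId_ev (F : EnrichedFunctor V Cᵒᵖ V) (A : C) {U : V} (y : U ⟶ F.obj (op A)) :
    lift (toUnit _ ≫ eId V A) y ≫ ev F A A = y := by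
  have := y ≫= ev_id F A
  rwa [← Category.assoc, CartesianMonoidalCategory.comp_lift, ← Category.assoc, comp_toUnit,
    Category.comp_id] at this

theorem lift_ev_comp (F : EnrichedFunctor V Cᵒᵖ V) {A B D : C} {U : V} (a : U ⟶ (A ⟶[V] B))
    (b : U ⟶ (B ⟶[V] D)) (y : U ⟶ F.obj (op D)) :
    lift (lift a b ≫ eComp V A B D) y ≫ ev F A D = lift a (lift b y ≫ ev F B D) ≫ ev F A B := by
  have := lift (lift a b) y ≫= ev_comp F A B D
  rwa [lift_lift_associator_hom_assoc, lift_whiskerLeft_assoc, lift_whiskerRight_assoc,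
    eq_comm] at this

variable (V) in
/-- The transpose `C(A, B) ⟶ [C(B, D), C(A, D)]` of the composition map of `C`. -/
def representableMap (A B D : C) : (A ⟶[V] B) ⟶ (ihom (B ⟶[V] D)).obj (A ⟶[V] D) :=
  MonoidalClosed.curry ((β_ (B ⟶[V] D) (A ⟶[V] B)).hom ≫ eComp V A B D)

theorem braiding_uncurry_representableMap (A B D : C) :
    (β_ _ _).hom ≫ MonoidalClosed.uncurry (representableMap V A B D) = eComp V A B D := by
  rw [representableMap, MonoidalClosed.uncurry_curry, SymmetricCategory.symmetry_assoc]

variable (V) in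
/-- The representable `V`-functor `C(-, D) : Cᵒᵖ ⥤ V`, whose action maps are the composition maps
of `C`. -/
def representable (D : C) : EnrichedFunctor V Cᵒᵖ V where
  obj A := A.unop ⟶[V] D
  map A B := representableMap V B.unop A.unop D
  map_id A := (action_id_iff (eId V A.unop) _).2
    (by rw [braiding_uncurry_representableMap, eId_lift_comp])
  map_comp A B E := (action_comp_iff (eComp V E.unop B.unop A.unop) _ _ _).2 (by
    rw [braiding_uncurry_representableMap, braiding_uncurry_representableMap,
      braiding_uncurry_representableMap, ← e_assoc V E.unop B.unop A.unop D,
      Iso.hom_inv_id_assoc])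

theorem ev_representable (A B D : C) : ev (representable V D) A B = eComp V A B D :=
  braiding_uncurry_representableMap A B D

/-- A `V`-natural transformation between `V`-functors. (For general `V` this is stronger than
naturality with respect to the underlying ordinary functors.) -/
structure VNatTrans {D : Type*} [EnrichedCategory V D] (F G : EnrichedFunctor V C D) where
  app : ∀ A : C, 𝟙_ V ⟶ (F.obj A ⟶[V] G.obj A)
  naturality : ∀ A B : C,
    (ρ_ _).inv ≫ (F.map A B ⊗ₘ app B) ≫ eComp V (F.obj A) (F.obj B) (G.obj B) =
      (λ_ _).inv ≫ (app A ⊗ₘ G.map A B) ≫ eComp V (F.obj A) (G.obj A) (G.obj B)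

/-- `V`-natural isomorphisms: there is an inverse `V`-natural transformation. -/
def VNatTrans.IsIso {D : Type*} [EnrichedCategory V D] {F G : EnrichedFunctor V C D}
    (α : VNatTrans F G) : Prop :=
  ∃ β : VNatTrans G F, ∀ A : C,
    (λ_ _).inv ≫ (α.app A ⊗ₘ β.app A) ≫ eComp V _ _ _ = eId V (F.obj A) ∧
    (λ_ _).inv ≫ (β.app A ⊗ₘ α.app A) ≫ eComp V _ _ _ = eId V (G.obj A)

/-- The component `F A ⟶ G A` of a `V`-natural transformation of presheaves, i.e. the transpose of
`α_A : * ⟶ [F A, G A]`. -/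
def evNat {F G : EnrichedFunctor V Cᵒᵖ V} (α : VNatTrans F G) (A : C) :
    F.obj (op A) ⟶ G.obj (op A) :=
  MonoidalClosed.uncurry' (α.app (op A))

/-- `F` is `V`-representable by `(D, x)`: the `V`-natural transformation `α : C(-, D) ⟶ F`
corresponding to `x : * ⟶ F D` under the Yoneda lemma, i.e. with
`* --id_D--> C(D, D) --α_D--> F D` equal to `x`, is a `V`-natural isomorphism. -/
def IsRepresentableBy (F : EnrichedFunctor V Cᵒᵖ V) (D : C) (x : 𝟙_ V ⟶ F.obj (op D)) : Prop :=
  ∃ α : VNatTrans (representable V D) F,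
    (eId V D : 𝟙_ V ⟶ (representable V D).obj (op D)) ≫ evNat α D = x ∧ α.IsIso

end Presheaf

section Elements

variable {V : Type u} [Category.{v} V] [CartesianMonoidalCategory V] [BraidedCategory V]
  [MonoidalClosed V] [IsExtensive.{w} V] {C : Type w} [EnrichedCategory V C]
  (F : EnrichedFunctor V Cᵒᵖ V)

/-- The family `(F A)_A`. -/
abbrev elFam₀ (A : C) : V := F.obj (op A)

/-- The family `(C(A, B) ⊗ F B)_{A, B}`. -/
abbrev elFam₁ (p : C × C) : V := (p.1 ⟶[V] p.2) ⊗ F.obj (op p.2)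

/-- The object of objects `⨆ F A`. -/
abbrev elObj : V := ∐ elFam₀ F

/-- The object of morphisms `⨆ C(A, B) ⊗ F B`. -/
abbrev elMor : V := ∐ elFam₁ F

abbrev elι₀ (A : C) : F.obj (op A) ⟶ elObj F := Sigma.ι (elFam₀ F) A
abbrev elι₁ (A B : C) : (A ⟶[V] B) ⊗ F.obj (op B) ⟶ elMor F := Sigma.ι (elFam₁ F) (A, B)

/-- The source map, given by the action of `C` on `F`. -/
def elSrc : elMor F ⟶ elObj F := Sigma.desc fun p => ev F p.1 p.2 ≫ elι₀ F p.1

/-- The target map, given by the projections `C(A, B) ⊗ F B ⟶ F B`. -/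
def elTgt : elMor F ⟶ elObj F := Sigma.desc fun p => snd _ _ ≫ elι₀ F p.2

/-- The identity map, given by `id_A ⊗ F A`. -/
def elIdt : elObj F ⟶ elMor F :=
  Sigma.desc fun A => lift (toUnit _ ≫ eId V A) (𝟙 (F.obj (op A))) ≫ elι₁ F A A

@[simp]
theorem elι_src (A B : C) : elι₁ F A B ≫ elSrc F = ev F A B ≫ elι₀ F A :=
  Sigma.ι_desc (f := elFam₁ F) _ (A, B)

@[simp]
theorem elι_src_assoc (A B : C) {Z : V} (z : _ ⟶ Z) :
    elι₁ F A B ≫ elSrc F ≫ z =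
      ev F A B ≫ elι₀ F A ≫ z := by
  rw [← Category.assoc, elι_src]
  try simp only [Category.assoc]


@[simp]
theorem elι_tgt (A B : C) : elι₁ F A B ≫ elTgt F = snd _ _ ≫ elι₀ F B :=
  Sigma.ι_desc (f := elFam₁ F) _ (A, B)

@[simp]
theorem elι_tgt_assoc (A B : C) {Z : V} (z : _ ⟶ Z) :
    elι₁ F A B ≫ elTgt F ≫ z =
      snd _ _ ≫ elι₀ F B ≫ z := by
  rw [← Category.assoc, elι_tgt]
  try simp only [Category.assoc]


@[simp]
theorem elι_idt (A : C) : elι₀ F A ≫ elIdt F =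
    lift (toUnit _ ≫ eId V A) (𝟙 (F.obj (op A))) ≫ elι₁ F A A :=
  Sigma.ι_desc (f := elFam₀ F) _ A

@[simp]
theorem elι_idt_assoc (A : C) {Z : V} (z : _ ⟶ Z) :
    elι₀ F A ≫ elIdt F ≫ z =
      lift (toUnit _ ≫ eId V A) (𝟙 (F.obj (op A))) ≫ elι₁ F A A ≫ z := by
  rw [← Category.assoc, elι_idt]
  try simp only [Category.assoc]


variable {F} in
/-- Equality of maps out of `X` may be checked locally, where a given composable pair of
generalized morphisms of `∫ F` is given by an element of `C(A, B) ⊗ C(B, D) ⊗ F D`. -/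
theorem el_hom_ext {X Z : V} (f g : X ⟶ elMor F) (h : f ≫ elTgt F = g ≫ elSrc F) {a b : X ⟶ Z}
    (H : ∀ (A B D : C) (U : V) (r : U ⟶ X) (k : U ⟶ (A ⟶[V] B) ⊗ (B ⟶[V] D) ⊗ F.obj (op D)),
      r ≫ f = k ≫ ((A ⟶[V] B) ◁ ev F B D) ≫ elι₁ F A B → r ≫ g = k ≫ snd _ _ ≫ elι₁ F B D →
        r ≫ a = r ≫ b) : a = b := by
  refine cover_hom_ext f fun p U r q hr => cover_hom_ext (r ≫ g) fun p' U' r' q' hr' => ?_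
  obtain ⟨A, B⟩ := p
  obtain ⟨B', D⟩ := p'
  have e : (r' ≫ q ≫ snd _ _) ≫ elι₀ F B = (q' ≫ ev F B' D) ≫ elι₀ F B' := by
    have h1 := congrArg (fun t => r' ≫ t ≫ elTgt F) hr
    have h2 := congrArg (fun t => t ≫ elSrc F) hr'
    simp only [Category.assoc] at h1 h2
    rw [elι_src] at h2
    rw [elι_tgt, h] at h1
    simp only [Category.assoc]
    rw [← h1, ← h2]
  by_cases hB : B = B'
  · subst hB
    have e' := ι_cancel (Y := elFam₀ F) (i := B) (g := r' ≫ q ≫ snd _ _) (g' := q' ≫ ev F B D) e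
    rw [← Category.assoc, ← Category.assoc]
    refine H A B D U' (r' ≫ r) (lift (r' ≫ q ≫ fst _ _) q') ?_ ?_
    · have : lift (r' ≫ q ≫ fst _ _) q' ≫ ((A ⟶[V] B) ◁ ev F B D) = r' ≫ q := by
        ext <;> simp [← e']
      rw [reassoc_of% this, Category.assoc, hr]
    · rw [lift_snd_assoc, Category.assoc, hr']
  · exact (isInitial_of_ne (Y := elFam₀ F) hB (r' ≫ q ≫ snd _ _) (q' ≫ ev F B' D) e).some.hom_ext _ _

theorem el_index {A B A' B' : C} (h : (A, B) ≠ (A', B')) {U Z : V}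
    (g : U ⟶ (A ⟶[V] B) ⊗ F.obj (op B)) (g' : U ⟶ (A' ⟶[V] B') ⊗ F.obj (op B'))
    (e : g ≫ elι₁ F A B = g' ≫ elι₁ F A' B') (a b : U ⟶ Z) : a = b :=
  (isInitial_of_ne (Y := elFam₁ F) h g g' e).some.hom_ext _ _

variable {F} in
theorem el_cancel {A B : C} {U : V} {g g' : U ⟶ (A ⟶[V] B) ⊗ F.obj (op B)}
    (e : g ≫ elι₁ F A B = g' ≫ elι₁ F A B) : g = g' :=
  ι_cancel (Y := elFam₁ F) (i := (A, B)) e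

theorem elIdt_src : elIdt F ≫ elSrc F = 𝟙 _ := by
  apply Sigma.hom_ext
  intro A
  change elι₀ F A ≫ _ = elι₀ F A ≫ _
  rw [elι_idt_assoc, elι_src, Category.comp_id, ← Category.assoc, ev_id, Category.id_comp]

theorem elIdt_tgt : elIdt F ≫ elTgt F = 𝟙 _ := by
  apply Sigma.hom_ext
  intro A
  change elι₀ F A ≫ _ = elι₀ F A ≫ _
  rw [elι_idt_assoc, elι_tgt, Category.comp_id, lift_snd_assoc, Category.id_comp]

section

variable [HasPullbacks V]

/-- The inclusion of `C(A, B) ⊗ C(B, D) ⊗ F D` in the object of composable pairs. -/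
def elPair (A B D : C) :
    (A ⟶[V] B) ⊗ (B ⟶[V] D) ⊗ F.obj (op D) ⟶ pullback (elTgt F) (elSrc F) :=
  pullback.lift (((A ⟶[V] B) ◁ ev F B D) ≫ elι₁ F A B) (snd _ _ ≫ elι₁ F B D) (by simp)

@[simp]
theorem elPair_fst (A B D : C) : elPair F A B D ≫ pullback.fst _ _ =
    ((A ⟶[V] B) ◁ ev F B D) ≫ elι₁ F A B := pullback.lift_fst _ _ _

@[simp]
theorem elPair_fst_assoc (A B D : C) {Z : V} (z : _ ⟶ Z) :
    elPair F A B D ≫ pullback.fst _ _ ≫ z =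
      ((A ⟶[V] B) ◁ ev F B D) ≫ elι₁ F A B ≫ z := by
  rw [← Category.assoc, elPair_fst]
  try simp only [Category.assoc]


@[simp]
theorem elPair_snd (A B D : C) : elPair F A B D ≫ pullback.snd _ _ =
    snd _ _ ≫ elι₁ F B D := pullback.lift_snd _ _ _

@[simp]
theorem elPair_snd_assoc (A B D : C) {Z : V} (z : _ ⟶ Z) :
    elPair F A B D ≫ pullback.snd _ _ ≫ z =
      snd _ _ ≫ elι₁ F B D ≫ z := by
  rw [← Category.assoc, elPair_snd]
  try simp only [Category.assoc]


variable {F} in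
theorem elPair_cancel {A B D : C} {U : V}
    {g g' : U ⟶ (A ⟶[V] B) ⊗ (B ⟶[V] D) ⊗ F.obj (op D)}
    (e : g ≫ elPair F A B D = g' ≫ elPair F A B D) : g = g' := by
  have e1 := e =≫ pullback.fst _ _
  have e2 := e =≫ pullback.snd _ _
  simp only [Category.assoc, elPair_fst, elPair_snd] at e1 e2
  simp only [← Category.assoc] at e1 e2
  have e1' := el_cancel e1 =≫ fst _ _
  have e2' := el_cancel e2
  simp only [Category.assoc, whiskerLeft_fst] at e1'
  exact CartesianMonoidalCategory.hom_ext _ _ e1' e2'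

/-- A map out of the object of composable pairs of `∫ F` from maps out of the objects
`C(A, B) ⊗ C(B, D) ⊗ F D`. -/
theorem exists_elDesc {Z : V}
    (h : ∀ A B D : C, (A ⟶[V] B) ⊗ (B ⟶[V] D) ⊗ F.obj (op D) ⟶ Z) :
    ∃ m : pullback (elTgt F) (elSrc F) ⟶ Z, ∀ A B D, elPair F A B D ≫ m = h A B D := by
  let P : ∀ {U : V}, (U ⟶ pullback (elTgt F) (elSrc F)) → (U ⟶ Z) → Prop := fun {U} r t =>
    ∀ (A B D : C) (v : U ⟶ (A ⟶[V] B) ⊗ (B ⟶[V] D) ⊗ F.obj (op D)),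
      r = v ≫ elPair F A B D → t = v ≫ h A B D
  have key : ∀ (p : C × C) (U : V) (r : U ⟶ pullback (elTgt F) (elSrc F))
      (q : U ⟶ elFam₁ F p), r ≫ pullback.fst _ _ = q ≫ Sigma.ι (elFam₁ F) p →
        ∃ t : U ⟶ Z, ∀ (U' : V) (s : U' ⟶ U), P (s ≫ r) (s ≫ t) := ?_
  · obtain ⟨m, hm⟩ := glue (pullback.fst (elTgt F) (elSrc F)) P key
    refine ⟨m, fun A B D => ?_⟩
    have := hm (A, B) _ (elPair F A B D) _ (elPair_fst F A B D) A B D (𝟙 _)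
      (Category.id_comp _).symm
    rwa [Category.id_comp] at this
  rintro ⟨A, B⟩ U r q hq
  have key' : ∀ (p : C × C) (U' : V) (r' : U' ⟶ U) (q' : U' ⟶ elFam₁ F p),
      r' ≫ r ≫ pullback.snd (elTgt F) (elSrc F) = q' ≫ Sigma.ι (elFam₁ F) p →
        ∃ t : U' ⟶ Z, ∀ (U'' : V) (s : U'' ⟶ U'), P ((s ≫ r') ≫ r) (s ≫ t) := ?_
  · obtain ⟨t, ht⟩ := glue (r ≫ pullback.snd (elTgt F) (elSrc F))
      (fun {U'} s t => P (s ≫ r) t) key'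
    refine ⟨t, fun U' s A' B' D' v hv => ?_⟩
    refine ht (B', D') U' s (v ≫ snd _ _) ?_ A' B' D' v hv
    rw [← Category.assoc, hv, Category.assoc, elPair_snd, Category.assoc]
  rintro ⟨B', D⟩ U' r' q' hq'
  by_cases hB : B = B'
  · subst hB
    refine ⟨lift (r' ≫ q ≫ fst _ _) q' ≫ h A B D, fun U'' s A₁ B₁ D₁ v hv => ?_⟩
    have e1 : (s ≫ r' ≫ q) ≫ elι₁ F A B =
        (v ≫ ((A₁ ⟶[V] B₁) ◁ ev F B₁ D₁)) ≫ elι₁ F A₁ B₁ := by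
      have := hv =≫ pullback.fst _ _
      simp only [Category.assoc, elPair_fst] at this
      rw [hq] at this
      simpa only [Category.assoc] using this
    have e2 : (s ≫ q') ≫ elι₁ F B D = (v ≫ snd _ _) ≫ elι₁ F B₁ D₁ := by
      have := hv =≫ pullback.snd _ _
      simp only [Category.assoc, elPair_snd] at this
      rw [hq'] at this
      simpa only [Category.assoc] using this
    by_cases h1 : (A, B) = (A₁, B₁)
    · obtain ⟨rfl, rfl⟩ := Prod.mk.inj h1
      by_cases h2 : (B, D) = (B, D₁)
      · obtain ⟨-, rfl⟩ := Prod.mk.inj h2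
        have e1' := el_cancel e1 =≫ fst _ _
        have e2' := el_cancel e2
        simp only [Category.assoc, whiskerLeft_fst] at e1'
        rw [← Category.assoc]
        congr 1
        apply CartesianMonoidalCategory.hom_ext
        · simpa using e1'
        · simpa using e2'
      · exact el_index F h2 _ _ e2 _ _
    · exact el_index F h1 _ _ e1 _ _
  · have e : (r' ≫ q ≫ snd _ _) ≫ elι₀ F B = (q' ≫ ev F B' D) ≫ elι₀ F B' := by
      have h1 := congrArg (fun t => r' ≫ t ≫ elTgt F) hq
      have h2 := congrArg (fun t => t ≫ elSrc F) hq'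
      simp only [Category.assoc] at h1 h2
      rw [elι_src] at h2
      rw [elι_tgt, pullback.condition] at h1
      simp only [Category.assoc]
      rw [← h1, ← h2]
    have hU := (isInitial_of_ne (Y := elFam₀ F) hB (r' ≫ q ≫ snd _ _) (q' ≫ ev F B' D) e).some
    refine ⟨hU.to _, fun U'' s A₁ B₁ D₁ v hv => ?_⟩
    have e3 : (s ≫ r' ≫ q ≫ snd _ _) ≫ elι₀ F B = (s ≫ q' ≫ ev F B' D) ≫ elι₀ F B' := by
      rw [Category.assoc, e, ← Category.assoc, Category.assoc]
    exact (isInitial_of_ne (Y := elFam₀ F) hB (s ≫ r' ≫ q ≫ snd _ _)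
      (s ≫ q' ≫ ev F B' D) e3).some.hom_ext _ _

/-- The composition of `∫ F`, determined by the maps
`c_{A, B, D} ⊗ F D : C(A, B) ⊗ C(B, D) ⊗ F D ⟶ C(A, D) ⊗ F D` (see `elPair_comp` and, for
uniqueness, `elPair_hom_ext`). -/
def elComp : pullback (elTgt F) (elSrc F) ⟶ elMor F :=
  (exists_elDesc F fun A B D =>
    (α_ _ _ _).inv ≫ (eComp V A B D ▷ F.obj (op D)) ≫ elι₁ F A D).choose

@[simp]
theorem elPair_comp (A B D : C) : elPair F A B D ≫ elComp F =
    (α_ _ _ _).inv ≫ (eComp V A B D ▷ F.obj (op D)) ≫ elι₁ F A D :=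
  (exists_elDesc F fun A B D =>
    (α_ _ _ _).inv ≫ (eComp V A B D ▷ F.obj (op D)) ≫ elι₁ F A D).choose_spec A B D

@[simp]
theorem elPair_comp_assoc (A B D : C) {Z : V} (z : _ ⟶ Z) :
    elPair F A B D ≫ elComp F ≫ z =
      (α_ _ _ _).inv ≫ (eComp V A B D ▷ F.obj (op D)) ≫ elι₁ F A D ≫ z := by
  rw [← Category.assoc, elPair_comp]
  try simp only [Category.assoc]


theorem elPair_hom_ext {Z : V} {a b : pullback (elTgt F) (elSrc F) ⟶ Z}
    (H : ∀ A B D, elPair F A B D ≫ a = elPair F A B D ≫ b) : a = b := by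
  refine el_hom_ext (pullback.fst _ _) (pullback.snd _ _) pullback.condition
    fun A B D U r k h1 h2 => ?_
  have : r = k ≫ elPair F A B D := by
    apply pullback.hom_ext
    · rw [h1, Category.assoc, elPair_fst]
    · rw [h2, Category.assoc, elPair_snd]
  rw [this, Category.assoc, Category.assoc, H]

/-- The composite of two composable generalized morphisms of `∫ F`. -/
theorem lift_elComp {A B D : C} {U : V} {f g : U ⟶ elMor F} (h : f ≫ elTgt F = g ≫ elSrc F)
    (a : U ⟶ (A ⟶[V] B)) (b : U ⟶ (B ⟶[V] D)) (y : U ⟶ F.obj (op D))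
    (h1 : f = lift a (lift b y ≫ ev F B D) ≫ elι₁ F A B) (h2 : g = lift b y ≫ elι₁ F B D) :
    pullback.lift f g h ≫ elComp F = lift (lift a b ≫ eComp V A B D) y ≫ elι₁ F A D := by
  have : pullback.lift f g h = lift a (lift b y) ≫ elPair F A B D := by
    apply pullback.hom_ext
    · rw [pullback.lift_fst, h1, Category.assoc, elPair_fst, lift_whiskerLeft_assoc]
    · rw [pullback.lift_snd, h2, Category.assoc, elPair_snd, lift_snd_assoc]
  rw [this, Category.assoc, elPair_comp, lift_lift_associator_inv_assoc, lift_whiskerRight_assoc]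

theorem comp_lift_elComp {U U' : V} (s : U' ⟶ U) {f g : U ⟶ elMor F}
    (h : f ≫ elTgt F = g ≫ elSrc F) : s ≫ pullback.lift f g h ≫ elComp F =
      pullback.lift (s ≫ f) (s ≫ g) (by simp [h]) ≫ elComp F := by
  rw [← Category.assoc]
  congr 1
  apply pullback.hom_ext <;> simp [pullback.lift_fst, pullback.lift_snd]

theorem elComp_src : elComp F ≫ elSrc F = pullback.fst _ _ ≫ elSrc F := by
  refine elPair_hom_ext F fun A B D => ?_
  rw [elPair_comp_assoc, elι_src, ← Category.assoc (_ ▷ _), ← ev_comp, elPair_fst_assoc, elι_src]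
  simp

theorem elComp_tgt : elComp F ≫ elTgt F = pullback.snd _ _ ≫ elTgt F := by
  refine elPair_hom_ext F fun A B D => ?_
  rw [elPair_comp_assoc, elι_tgt, elPair_snd_assoc, elι_tgt]
  simp

/-- The internal category of elements `∫ F` of a `V`-functor `F : Cᵒᵖ ⥤ V`. -/
def elements : InternalCat V where
  Obj := elObj F
  Mor := elMor F
  src := elSrc F
  tgt := elTgt F
  idt := elIdt F
  comp := elComp F
  idt_src := elIdt_src F
  idt_tgt := elIdt_tgt F
  comp_src := elComp_src F
  comp_tgt := elComp_tgt F
  id_comp := by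
    apply Sigma.hom_ext
    rintro ⟨A, B⟩
    change elι₁ F A B ≫ _ = elι₁ F A B ≫ _
    rw [comp_lift_elComp, lift_elComp F _ (toUnit _ ≫ eId V A) (fst _ _) (snd _ _)]
    · rw [Category.comp_id, lift_eId_comp, lift_fst_snd, Category.id_comp]
    · have := (ev F A B) ≫= elι_idt F A
      rw [elι_src_assoc, this, lift_fst_snd, Category.id_comp, ← Category.assoc,
        CartesianMonoidalCategory.comp_lift, Category.comp_id, ← Category.assoc, comp_toUnit]
    · rw [Category.comp_id, lift_fst_snd, Category.id_comp]
  comp_id := by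
    apply Sigma.hom_ext
    rintro ⟨A, B⟩
    change elι₁ F A B ≫ _ = elι₁ F A B ≫ _
    rw [comp_lift_elComp, lift_elComp F _ (fst _ _) (toUnit _ ≫ eId V B) (snd _ _)]
    · rw [Category.comp_id, lift_comp_eId, lift_fst_snd, Category.id_comp]
    · rw [Category.comp_id, lift_eId_ev, lift_fst_snd, Category.id_comp]
    · have := (snd (A ⟶[V] B) (F.obj (op B))) ≫= elι_idt F B
      rw [elι_tgt_assoc, this, ← Category.assoc,
        CartesianMonoidalCategory.comp_lift, Category.comp_id, ← Category.assoc, comp_toUnit]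
  assoc f g h hfg hgh := by
    refine el_hom_ext f g hfg fun A B D U r k h1 h2 => ?_
    refine el_hom_ext (r ≫ g) (r ≫ h) (by simp [hgh]) fun B' D' E U' r' k' h1' h2' => ?_
    rw [h2] at h1'
    have e : (r' ≫ k ≫ snd _ _) ≫ elι₁ F B D =
        (k' ≫ ((B' ⟶[V] D') ◁ ev F D' E)) ≫ elι₁ F B' D' := by
      simpa only [Category.assoc] using h1'
    by_cases hi : (B, D) = (B', D')
    · obtain ⟨rfl, rfl⟩ := Prod.mk.inj hi
      obtain ⟨a, k, rfl⟩ : ∃ a k₂, k = lift a k₂ := ⟨k ≫ fst _ _, k ≫ snd _ _, by simp⟩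
      obtain ⟨b, k', rfl⟩ : ∃ a k₂, k' = lift a k₂ := ⟨k' ≫ fst _ _, k' ≫ snd _ _, by simp⟩
      obtain ⟨c, y, rfl⟩ : ∃ a k₂, k' = lift a k₂ := ⟨k' ≫ fst _ _, k' ≫ snd _ _, by simp⟩
      have e' := el_cancel e
      rw [lift_snd, lift_whiskerLeft] at e'
      have hf : r' ≫ r ≫ f = lift (r' ≫ a) (lift b (lift c y ≫ ev F D E) ≫ ev F B D) ≫
          elι₁ F A B := by
        rw [h1, lift_whiskerLeft_assoc, ← e', ← Category.assoc,
          CartesianMonoidalCategory.comp_lift, Category.assoc]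
      have hg : r' ≫ r ≫ g = lift b (lift c y ≫ ev F D E) ≫ elι₁ F B D := by
        rw [h2, ← e', lift_snd_assoc, Category.assoc]
      have hh : r' ≫ r ≫ h = lift c y ≫ elι₁ F D E := by
        rw [h2', lift_snd_assoc]
      have q1 := lift_elComp F (f := r' ≫ r ≫ f) (g := r' ≫ r ≫ g) (by simp [hfg]) _ _ _ hf hg
      have q2 := lift_elComp F (f := r' ≫ r ≫ g) (g := r' ≫ r ≫ h) (by simp [hgh]) _ _ _ hg hh
      simp only [comp_lift_elComp]
      rw [lift_elComp F _ (lift (r' ≫ a) b ≫ eComp V A B D) c y (q1.trans ?_) hh,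
        lift_elComp F _ (r' ≫ a) (lift b c ≫ eComp V B D E) y (hf.trans ?_) q2,
        lift_eComp_assoc]
      · rw [lift_ev_comp]
      · rfl
    · exact el_index F hi _ _ e _ _

/-- The element `(D, x) : * ⟶ ∫ F` given by an element `x : * ⟶ F D`. -/
def elementOf (D : C) (x : 𝟙_ V ⟶ F.obj (op D)) : InternalCat.cst (𝟙_ V) ⟶ elements F :=
  InternalCat.cstHom (A := elements F) (x ≫ elι₀ F D)

end

end Elements

end VRep

end

noncomputable section

namespace VRep

/-! ### Internal terminal objects in terms of generalized elements -/

namespace InternalCat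

variable {V : Type u} [Category.{v} V] [HasPullbacks V]

/-! Both conditions are equivalent to a third one: for every `A`, the map `yonedaMap F x A`, which
sends `g` in `C(A, D)` to the action of `g` on `x`, is an isomorphism.

On the representability side this is the enriched Yoneda lemma. Transposing along the closed
structure turns `V`-natural transformations of presheaves into families of maps compatible with the
action maps (`naturality_iff`), and such a transformation is invertible exactly when its components
are (`VNatTrans.isIso_iff`). The components of the transformation determined by `x` are the maps
`yonedaMap F x A` (`evNat_eq_yonedaMap`).

On the side of the category of elements, `isInternalTerminal_iff` replaces the invertibility of the
slice projection by an elementwise property: every generalized object `a : X ⟶ A.Obj` has exactly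
one generalized morphism to the constant object `T`. In `∫ F`, a morphism from `y` in `F A` to `(D,
x)` should be an element `g` of `C(A, D)` whose action on `x` is `y`, so unique existence for all
`y` says that `yonedaMap F x A` is invertible.

Extensivity makes the last statement precise. A generalized morphism with source in the summand `F
A` and target `(D, x)` might be spread over several summands of the object of morphisms;
disjointness of coproducts forces it into the summand of `(A, D)`, and since coproduct inclusions
are monic its second coordinate must be `x` (`exists_eq_toElement`). -/

theorem cst_hom_mor {A : InternalCat V} {X : V} (F : cst X ⟶ A) : F.mor = F.obj ≫ A.idt :=
  (Category.id_comp _).symm.trans F.idt_mor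

/-- All morphisms of `cst X` are identities, so functors out of it are just generalized objects.
This lets statements about functors and slices be tested on generalized elements. -/
theorem cst_hom_ext {A : InternalCat V} {X : V} {F G : cst X ⟶ A} (h : F.obj = G.obj) : F = G :=
  hom_ext h (by rw [cst_hom_mor, cst_hom_mor, h])

variable [CartesianMonoidalCategory V]

/-- The constant generalized object of `A` at an element `T`. -/
def constTo {A : InternalCat V} (T : cst (𝟙_ V) ⟶ A) (X : V) : X ⟶ A.Obj := toUnit X ≫ T.obj

@[simp]
theorem comp_constTo {A : InternalCat V} (T : cst (𝟙_ V) ⟶ A) {X Y : V} (f : X ⟶ Y) :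
    f ≫ constTo T Y = constTo T X :=
  (Category.assoc _ _ _).symm.trans (congrArg (· ≫ T.obj) (comp_toUnit f))

@[simp]
theorem comp_constTo_assoc {A : InternalCat V} (T : cst (𝟙_ V) ⟶ A) {X Y Z : V} (f : X ⟶ Y)
    (z : A.Obj ⟶ Z) : f ≫ constTo T Y ≫ z = constTo T X ≫ z := by
  rw [← Category.assoc, comp_constTo]

/-- `T` is a terminal object on generalized elements: every generalized object of `A` has a
unique morphism to `T`. -/
def HasUniqueMorphismsTo {A : InternalCat V} (T : cst (𝟙_ V) ⟶ A) : Prop :=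
  ∀ (X : V) (a : X ⟶ A.Obj), ∃! f : X ⟶ A.Mor, f ≫ A.src = a ∧ f ≫ A.tgt = constTo T X

section

variable {A : InternalCat V} {T : cst (𝟙_ V) ⟶ A}

theorem HasUniqueMorphismsTo.hom_ext (h : HasUniqueMorphismsTo T) {X : V} {f g : X ⟶ A.Mor}
    (h₁ : f ≫ A.src = g ≫ A.src) (h₂ : f ≫ A.tgt = constTo T X)
    (h₃ : g ≫ A.tgt = constTo T X) : f = g :=
  (h X (g ≫ A.src)).unique ⟨h₁, h₂⟩ ⟨rfl, h₃⟩

/-- The section of `arrowDom A` given by the universal morphisms to `T`. -/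
def HasUniqueMorphismsTo.toArrow (h : HasUniqueMorphismsTo T) (f : A.Obj ⟶ A.Mor)
    (h₁ : f ≫ A.src = 𝟙 _) (h₂ : f ≫ A.tgt = constTo T _) : A ⟶ arrow A where
  obj := f
  -- A morphism `m : a ⟶ b` goes to the square with left side `m`, right side the identity of `T`,
  -- and top and bottom the chosen morphisms from `a` and `b` to `T`. It commutes because both
  -- composites are morphisms from `a` to `T`.
  mor := sqLift (A.src ≫ f) ((constTo T _) ≫ A.idt) (𝟙 _) (A.tgt ≫ f)
    (by simp [h₂])
    (by simp [h₁]) (h.hom_ext (by simp [h₁]) (by simp) (by simp [h₂]))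
  mor_src := sqLift_top _ _ _ _ _ _ _
  mor_tgt := sqLift_bot _ _ _ _ _ _ _
  idt_mor := by
    apply sq_hom_ext
    · simp [arrow]
    · simp [arrow, reassoc_of% h₂]
    · simp [arrow, reassoc_of% h₁]
    · simp [arrow]
  comp_mor := by
    refine Hom.comp_mor_of (B := arrow A) _ _ (Eq.trans ?_ (arrow_mcomp _).symm)
    apply sq_hom_ext
    · simp [sqPaste]
    -- The right side of the pasted square is the composite of two identities of `T`.
    · have h₃ := A.mcomp_id (constTo T (pullback A.tgt A.src) ≫ A.idt) (a := constTo T _) (by simp)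
      simpa [sqPaste] using h₃.symm
    · simp [sqPaste]
    · simp [sqPaste]

variable (T) in
/-- The projection from the slice to the category of arrows. -/
def sliceArrow : slice T ⟶ arrow A :=
  pullback.snd (prod.lift (𝟙 A) (cstUnitIsTerminal.from A ≫ T))
    (prod.lift (arrowDom A) (arrowCod A))

/-- This and `sliceArrow_cod` are the two components of the defining pullback square. Together with
`slice_hom_ext` and `exists_slice_lift` they describe functors into the slice as functors into
`arrow A` with codomain constant at `T`, so that the chosen pullback and product need not be
unfolded again. -/
theorem sliceArrow_dom : sliceArrow T ≫ arrowDom A = sliceProj T := by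
  have := pullback.condition (f := prod.lift (𝟙 A) (cstUnitIsTerminal.from A ≫ T))
    (g := prod.lift (arrowDom A) (arrowCod A)) =≫ Limits.prod.fst
  rw [Category.assoc, Category.assoc, prod.lift_fst, prod.lift_fst, Category.comp_id] at this
  exact this.symm

theorem sliceArrow_cod :
    sliceArrow T ≫ arrowCod A = sliceProj T ≫ cstUnitIsTerminal.from A ≫ T := by
  have := pullback.condition (f := prod.lift (𝟙 A) (cstUnitIsTerminal.from A ≫ T))
    (g := prod.lift (arrowDom A) (arrowCod A)) =≫ Limits.prod.snd
  rw [Category.assoc, Category.assoc, prod.lift_snd, prod.lift_snd] at this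
  exact this.symm

theorem comp_sliceArrow_cod {B : InternalCat V} (G : B ⟶ slice T) :
    (G ≫ sliceArrow T) ≫ arrowCod A = cstUnitIsTerminal.from B ≫ T := by
  rw [Category.assoc, sliceArrow_cod, ← Category.assoc, ← Category.assoc,
    cstUnitIsTerminal.hom_ext ((G ≫ sliceProj T) ≫ _) (cstUnitIsTerminal.from B)]

theorem slice_hom_ext {B : InternalCat V} {G H : B ⟶ slice T}
    (h₁ : G ≫ sliceProj T = H ≫ sliceProj T) (h₂ : G ≫ sliceArrow T = H ≫ sliceArrow T) :
    G = H :=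
  pullback.hom_ext h₁ h₂

/-- A functor to the slice `A / T` from a functor to the category of arrows. -/
theorem exists_slice_lift {B : InternalCat V} (F : B ⟶ arrow A)
    (h : cstUnitIsTerminal.from B ≫ T = F ≫ arrowCod A) :
    ∃ G : B ⟶ slice T, G ≫ sliceProj T = F ≫ arrowDom A ∧ G ≫ sliceArrow T = F := by
  have e : (F ≫ arrowDom A) ≫ cstUnitIsTerminal.from A = cstUnitIsTerminal.from B :=
    cstUnitIsTerminal.hom_ext _ _
  refine ⟨pullback.lift (F ≫ arrowDom A) F ?_, pullback.lift_fst _ _ _, pullback.lift_snd _ _ _⟩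
  apply Limits.prod.hom_ext
  · rw [Category.assoc, prod.lift_fst, Category.comp_id, Category.assoc, prod.lift_fst]
  · rw [Category.assoc, prod.lift_snd, Category.assoc F (prod.lift _ _), prod.lift_snd, ← h, ← e,
      Category.assoc, Category.assoc, Category.assoc]

/-- On objects, both functors pick morphisms to `T` with a common source, hence agree. On morphisms,
the top and bottom of a square are then fixed by the values on objects, while the left and right
sides are read off by `arrowDom` and `arrowCod`. -/
theorem HasUniqueMorphismsTo.arrow_hom_ext (h : HasUniqueMorphismsTo T) {B : InternalCat V}
    {F G : B ⟶ arrow A} (h₁ : F ≫ arrowDom A = G ≫ arrowDom A)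
    (h₂ : F ≫ arrowCod A = cstUnitIsTerminal.from B ≫ T)
    (h₃ : G ≫ arrowCod A = cstUnitIsTerminal.from B ≫ T) : F = G := by
  have hT : (cstUnitIsTerminal.from B ≫ T).obj = constTo T _ :=
    congrArg (· ≫ T.obj) (toUnit_unique _ _)
  have e : F.obj = G.obj :=
    h.hom_ext (congrArg Hom.obj h₁) ((congrArg Hom.obj h₂).trans hT)
      ((congrArg Hom.obj h₃).trans hT)
  refine InternalCat.hom_ext e ?_
  apply sq_hom_ext
  · exact F.mor_src.trans ((congrArg _ e).trans G.mor_src.symm)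
  · exact congrArg Hom.mor (h₂.trans h₃.symm)
  · exact congrArg Hom.mor h₁
  · exact F.mor_tgt.trans ((congrArg _ e).trans G.mor_tgt.symm)

/-- The universal morphisms to `T` assemble into a functor `A ⟶ arrow A` with domain the identity
and codomain constant, which is a section of the slice projection. Uniqueness makes this section a
two-sided inverse. -/
theorem HasUniqueMorphismsTo.isInternalTerminal (h : HasUniqueMorphismsTo T) :
    IsInternalTerminal T := by
  -- The identity is the generic generalized object; its morphism to `T` is the universal family.
  obtain ⟨f, ⟨h₁, h₂⟩, -⟩ := h A.Obj (𝟙 _)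
  have hdom : h.toArrow f h₁ h₂ ≫ arrowDom A = 𝟙 A :=
    InternalCat.hom_ext h₁ (sqLift_left _ _ _ _ _ _ _)
  have hcod : cstUnitIsTerminal.from A ≫ T = h.toArrow f h₁ h₂ ≫ arrowCod A := by
    refine InternalCat.hom_ext (Eq.trans (congrArg (· ≫ T.obj) (toUnit_unique _ _)) h₂.symm)
      (Eq.trans ?_ (sqLift_right _ _ _ _ _ _ _).symm)
    exact (congrArg₂ (· ≫ ·) (toUnit_unique _ _) (cst_hom_mor T)).trans (Category.assoc _ _ _).symm
  obtain ⟨s, hs, -⟩ := exists_slice_lift _ hcod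
  rw [hdom] at hs
  refine ⟨s, ?_, hs⟩
  -- The endofunctor `sliceProj T ≫ s` of the slice and the identity lie over the same functor to
  -- `A`, so `arrow_hom_ext` identifies the functors to `arrow A` that they induce.
  have e : (sliceProj T ≫ s) ≫ sliceProj T = 𝟙 _ ≫ sliceProj T := by
    rw [Category.assoc, hs, Category.comp_id, Category.id_comp]
  refine slice_hom_ext e (h.arrow_hom_ext ?_ (comp_sliceArrow_cod _) (comp_sliceArrow_cod _))
  rw [Category.assoc _ _ (arrowDom A), Category.assoc _ _ (arrowDom A), sliceArrow_dom]
  exact e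

/-- A generalized object `a` is a functor `cst X ⟶ A`, and a morphism from `a` to `T` is a lift of
that functor to the slice. An invertible projection admits exactly one lift. -/
theorem IsInternalTerminal.hasUniqueMorphismsTo (h : IsInternalTerminal T) :
    HasUniqueMorphismsTo T := by
  have : IsIso (sliceProj T) := h
  intro X a
  obtain ⟨s, hs⟩ : ∃ s, s = (cstHom a ≫ inv (sliceProj T)) ≫ sliceArrow T := ⟨_, rfl⟩
  have s₁ : s ≫ arrowDom A = cstHom a := by
    rw [hs, Category.assoc, sliceArrow_dom, Category.assoc, IsIso.inv_hom_id, Category.comp_id]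
  have s₂ : s ≫ arrowCod A = cstUnitIsTerminal.from (cst X) ≫ T := by
    rw [hs, comp_sliceArrow_cod]
  have hT : (cstUnitIsTerminal.from (cst X) ≫ T).obj = constTo T X :=
    congrArg (· ≫ T.obj) (toUnit_unique _ _)
  refine ⟨s.obj, ⟨congrArg Hom.obj s₁, (congrArg Hom.obj s₂).trans hT⟩, ?_⟩
  rintro f ⟨h₁, h₂⟩
  -- A competing morphism `f` is a generalized object of `arrow A`, and its constant codomain lets
  -- it lift to the slice over `a`; the lift must be the one obtained from the inverse.
  obtain ⟨G, hG, hG'⟩ := exists_slice_lift (T := T) (cstHom (A := arrow A) f)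
    (cst_hom_ext (hT.trans h₂.symm))
  have e : G = cstHom a ≫ inv (sliceProj T) := by
    rw [IsIso.eq_comp_inv, hG]
    exact cst_hom_ext h₁
  have e' : cstHom (A := arrow A) f = s := by rw [← hG', e, hs]
  exact congrArg Hom.obj e'

/-- Internal terminal objects are detected by generalized elements. -/
theorem isInternalTerminal_iff : IsInternalTerminal T ↔ HasUniqueMorphismsTo T :=
  ⟨IsInternalTerminal.hasUniqueMorphismsTo, HasUniqueMorphismsTo.isInternalTerminal⟩

end

end InternalCat

/-! ### The enriched Yoneda lemma in terms of action maps -/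

section Yoneda

variable {V : Type u} [Category.{v} V] [CartesianMonoidalCategory V] [MonoidalClosed V]

theorem uncurry_eq_uncurry' {x y : V} (q : 𝟙_ V ⟶ (ihom x).obj y) :
    MonoidalClosed.uncurry q = (ρ_ x).hom ≫ MonoidalClosed.uncurry' q := by
  rw [MonoidalClosed.uncurry', Iso.hom_inv_id_assoc]

/-- This transposes the side of the `V`-naturality equation in which the component is applied last:
composing internally with an element of an internal hom becomes postcomposition with the map it
names. `uncurry_tensor_comp_left` treats the other side. -/
theorem uncurry_tensor_comp_right {P x y z : V} (p : P ⟶ (ihom x).obj y)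
    (q : 𝟙_ V ⟶ (ihom y).obj z) :
    MonoidalClosed.uncurry ((ρ_ P).inv ≫ (p ⊗ₘ q) ≫ MonoidalClosed.comp x y z) =
      MonoidalClosed.uncurry p ≫ MonoidalClosed.uncurry' q := by
  rw [MonoidalClosed.uncurry_natural_left, uncurry_tensor_comp, uncurry_eq_uncurry' q,
    rightUnitor_naturality_assoc]
  have : x ◁ (ρ_ P).inv ≫ (α_ x P (𝟙_ V)).inv ≫ (ρ_ (x ⊗ P)).hom = 𝟙 _ := by
    ext <;> simp
  rw [reassoc_of% this]

theorem uncurry_tensor_comp_left {Q x y z : V} (p : 𝟙_ V ⟶ (ihom x).obj y)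
    (q : Q ⟶ (ihom y).obj z) :
    MonoidalClosed.uncurry ((λ_ Q).inv ≫ (p ⊗ₘ q) ≫ MonoidalClosed.comp x y z) =
      (MonoidalClosed.uncurry' p ▷ Q) ≫ MonoidalClosed.uncurry q := by
  rw [MonoidalClosed.uncurry_natural_left, uncurry_tensor_comp, uncurry_eq_uncurry' p,
    MonoidalCategory.comp_whiskerRight_assoc]
  have : x ◁ (λ_ Q).inv ≫ (α_ x (𝟙_ V) Q).inv ≫ (ρ_ x).hom ▷ Q = 𝟙 _ := by
    ext <;> simp
  rw [reassoc_of% this]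

/-- The bijection between elements of `[x, y]` and maps `x ⟶ y` respects composition and identities,
so invertibility of a `V`-natural transformation can be checked on the underlying maps. -/
theorem comp_app_eq_id_iff {x y : V} (p : 𝟙_ V ⟶ (ihom x).obj y) (q : 𝟙_ V ⟶ (ihom y).obj x) :
    (λ_ _).inv ≫ (p ⊗ₘ q) ≫ MonoidalClosed.comp x y x = MonoidalClosed.id x ↔
      MonoidalClosed.uncurry' p ≫ MonoidalClosed.uncurry' q = 𝟙 x := by
  obtain ⟨p, rfl⟩ := MonoidalClosed.curryHomEquiv'.surjective p
  obtain ⟨q, rfl⟩ := MonoidalClosed.curryHomEquiv'.surjective q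
  simp only [MonoidalClosed.curryHomEquiv'_apply, MonoidalClosed.uncurry'_curry']
  rw [← MonoidalClosed.curry'_comp, ← MonoidalClosed.curry'_id]
  exact MonoidalClosed.curryHomEquiv'.injective.eq_iff

variable [BraidedCategory V] {C : Type w} [EnrichedCategory V C]
  {F G : EnrichedFunctor V Cᵒᵖ V}

/-- `V`-naturality in terms of action maps. -/
theorem naturality_iff (φ : ∀ A : Cᵒᵖ, 𝟙_ V ⟶ (ihom (F.obj A)).obj (G.obj A)) (A B : C) :
    ((ρ_ _).inv ≫ (F.map (op B) (op A) ⊗ₘ φ (op A)) ≫ eComp V _ _ (G.obj (op A)) =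
      (λ_ _).inv ≫ (φ (op B) ⊗ₘ G.map (op B) (op A)) ≫ eComp V (F.obj (op B)) _ _) ↔
    ev F A B ≫ MonoidalClosed.uncurry' (φ (op A)) =
      ((A ⟶[V] B) ◁ MonoidalClosed.uncurry' (φ (op B))) ≫ ev G A B := by
  -- Composition in `V` enriched over itself is `MonoidalClosed.comp`, and transposition is
  -- injective, so the transposes of the two sides may be compared. They differ from the action
  -- equation only by a braiding, which cancels.
  refine (MonoidalClosed.uncurry_injective.eq_iff (a := (ρ_ _).inv ≫ (F.map (op B) (op A) ⊗ₘ
    φ (op A)) ≫ MonoidalClosed.comp _ _ _) (b := (λ_ _).inv ≫ (φ (op B) ⊗ₘ G.map (op B) (op A)) ≫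
      MonoidalClosed.comp _ _ _)).symm.trans ?_
  erw [uncurry_tensor_comp_right, uncurry_tensor_comp_left]
  rw [ev, ev, Category.assoc, BraidedCategory.braiding_naturality_right_assoc, cancel_epi]
  rfl

theorem evNat_naturality (α : VNatTrans F G) (A B : C) :
    ev F A B ≫ evNat α A = ((A ⟶[V] B) ◁ evNat α B) ≫ ev G A B :=
  (naturality_iff α.app A B).1 (α.naturality (op B) (op A))

/-- A `V`-natural transformation from maps compatible with the action maps. -/
def VNatTrans.ofEv (φ : ∀ A : C, F.obj (op A) ⟶ G.obj (op A))
    (h : ∀ A B : C, ev F A B ≫ φ A = ((A ⟶[V] B) ◁ φ B) ≫ ev G A B) : VNatTrans F G where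
  app A := MonoidalClosed.curry' (φ A.unop)
  naturality A B := (naturality_iff (fun A => MonoidalClosed.curry' (φ A.unop)) B.unop A.unop).2
    (by rw [MonoidalClosed.uncurry'_curry', MonoidalClosed.uncurry'_curry']; exact h _ _)

@[simp]
theorem evNat_ofEv (φ : ∀ A : C, F.obj (op A) ⟶ G.obj (op A))
    (h : ∀ A B : C, ev F A B ≫ φ A = ((A ⟶[V] B) ◁ φ B) ≫ ev G A B) (A : C) :
    evNat (VNatTrans.ofEv φ h) A = φ A :=
  MonoidalClosed.uncurry'_curry' _

/-- A `V`-natural transformation of presheaves is invertible iff its components are. -/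
theorem VNatTrans.isIso_iff (α : VNatTrans F G) :
    α.IsIso ↔ ∀ A : C, CategoryTheory.IsIso (evNat α A) := by
  constructor
  · rintro ⟨β, hβ⟩ A
    exact ⟨evNat β A, (comp_app_eq_id_iff _ _).1 (hβ (op A)).1,
      (comp_app_eq_id_iff _ _).1 (hβ (op A)).2⟩
  · intro h
    -- Componentwise inverses inherit compatibility with the actions, hence form a `V`-natural
    -- transformation.
    have nat : ∀ A B : C, ev G A B ≫ inv (evNat α A) =
        ((A ⟶[V] B) ◁ inv (evNat α B)) ≫ ev F A B := fun A B => by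
      rw [IsIso.comp_inv_eq, Category.assoc, evNat_naturality,
        ← MonoidalCategory.whiskerLeft_comp_assoc, IsIso.inv_hom_id,
        MonoidalCategory.whiskerLeft_id, Category.id_comp]
    refine ⟨VNatTrans.ofEv (fun A => inv (evNat α A)) nat, fun A =>
      ⟨(comp_app_eq_id_iff _ _).2 ?_, (comp_app_eq_id_iff _ _).2 ?_⟩⟩
    · exact (congrArg _ (evNat_ofEv _ nat A.unop)).trans (IsIso.hom_inv_id (evNat α A.unop))
    · exact (congrArg (· ≫ evNat α A.unop) (evNat_ofEv _ nat A.unop)).trans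
        (IsIso.inv_hom_id (evNat α A.unop))

variable (F) {D : C} (x : 𝟙_ V ⟶ F.obj (op D))

/-- The map `C(A, D) ⟶ F A` given by acting on the element `x` of `F D`. -/
def yonedaMap (A : C) : (A ⟶[V] D) ⟶ F.obj (op A) :=
  lift (𝟙 _) (toUnit _ ≫ x) ≫ ev F A D

theorem comp_yonedaMap {A : C} {U : V} (g : U ⟶ (A ⟶[V] D)) :
    g ≫ yonedaMap F x A = lift g (toUnit U ≫ x) ≫ ev F A D := by
  rw [yonedaMap, ← Category.assoc, CartesianMonoidalCategory.comp_lift, Category.comp_id,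
    ← Category.assoc, comp_toUnit]

/-- Associativity of the action: acting on `x` by a composite is acting successively. This is the
naturality of the Yoneda transformation. -/
theorem eComp_yonedaMap (A B : C) :
    eComp V A B D ≫ yonedaMap F x A = ((A ⟶[V] B) ◁ yonedaMap F x B) ≫ ev F A B := by
  have h := lift_ev_comp F (fst (A ⟶[V] B) (B ⟶[V] D)) (snd _ _) (toUnit _ ≫ x)
  rw [lift_fst_snd, Category.id_comp] at h
  rw [comp_yonedaMap, h, ← comp_yonedaMap]
  congr 1
  ext <;> simp

/-- The `V`-natural transformation `C(-, D) ⟶ F` corresponding to the element `x` of `F D`. -/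
def yonedaTrans : VNatTrans (representable V D) F :=
  VNatTrans.ofEv (F := representable V D) (yonedaMap F x) fun A B =>
    (congrArg (· ≫ yonedaMap F x A) (ev_representable A B D)).trans (eComp_yonedaMap F x A B)

theorem evNat_yonedaTrans (A : C) : evNat (yonedaTrans F x) A = yonedaMap F x A :=
  evNat_ofEv (F := representable V D) _ _ A

theorem eId_yonedaMap : eId V D ≫ yonedaMap F x D = x := by
  rw [comp_yonedaMap, toUnit_unique (toUnit (𝟙_ V)) (𝟙 _), Category.id_comp]
  have := lift_eId_ev F D x
  rwa [toUnit_unique (toUnit (𝟙_ V)) (𝟙 _), Category.id_comp] at this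

/-- The uniqueness half of Yoneda: naturality along `g` in `C(A, D)`, evaluated at the identity of
`D`, shows that the component at `A` sends `g` to the action of `g` on `x`. -/
theorem evNat_eq_yonedaMap (α : VNatTrans (representable V D) F)
    (h : (eId V D : 𝟙_ V ⟶ (representable V D).obj (op D)) ≫ evNat α D = x) (A : C) :
    evNat α A = yonedaMap F x A := by
  -- The same components with their domains written as hom objects, so that the laws of `C` apply to
  -- them.
  let φ : ∀ A : C, (A ⟶[V] D) ⟶ F.obj (op A) := fun A => evNat α A
  have h₁ : eComp V A D D ≫ φ A = ((A ⟶[V] D) ◁ φ D) ≫ ev F A D :=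
    (congrArg (· ≫ φ A) (ev_representable A D D)).symm.trans (evNat_naturality α A D)
  have h₂ : eId V D ≫ φ D = x := h
  change φ A = _
  have h₃ := lift_comp_eId (𝟙 (A ⟶[V] D)) =≫ φ A
  rw [Category.assoc, h₁, lift_whiskerLeft_assoc, Category.assoc, h₂, Category.id_comp] at h₃
  exact h₃.symm

/-- The transformation in the definition exists, by `yonedaTrans`, and its components are forced, so
only their invertibility is left. -/
theorem isRepresentableBy_iff :
    IsRepresentableBy F D x ↔ ∀ A : C, IsIso (yonedaMap F x A) := by
  constructor
  · rintro ⟨α, h, hα⟩ A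
    rw [← evNat_eq_yonedaMap F x α h A]
    exact α.isIso_iff.1 hα A
  · intro h
    refine ⟨yonedaTrans F x, (congrArg _ (evNat_yonedaTrans F x D)).trans (eId_yonedaMap F x),
      (VNatTrans.isIso_iff _).2 fun A => ?_⟩
    rw [evNat_yonedaTrans]
    exact h A

end Yoneda

/-! ### Morphisms to `(D, x)` in the category of elements -/

section Elements

/-- In an extensive category, a map into a coproduct which avoids all summands but one factors
through that summand. -/
theorem exists_factor {V : Type u} [Category.{v} V] [CartesianMonoidalCategory V]
    [IsExtensive.{w} V] {I : Type w} {W : I → V} {X : V} (f : X ⟶ ∐ W) (i : I)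
    (H : ∀ (k : I) (U : V) (r : U ⟶ X) (q : U ⟶ W k), r ≫ f = q ≫ Sigma.ι W k → k ≠ i →
      Nonempty (IsInitial U)) : ∃ l : X ⟶ W i, l ≫ Sigma.ι W i = f := by
  -- Mapping each summand to the terminal object sends `∐ W` to a coproduct of terminal objects that
  -- records the index. It suffices that `f` has constant index `i`, which is clear on the piece
  -- over `i`, while the other pieces are initial.
  obtain ⟨l, ⟨hl, -⟩, -⟩ := exists_unique_lift (Y := fun _ : I => 𝟙_ V)
    (fun k => toUnit (W k)) i f (toUnit X) (by
      refine cover_hom_ext f fun k U r q h => ?_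
      by_cases hk : k = i
      · subst hk
        rw [reassoc_of% h, Sigma.ι_map, ← Category.assoc, ← Category.assoc,
          toUnit_unique (q ≫ _) (r ≫ _)]
      · exact (H k U r q h hk).some.hom_ext _ _)
  exact ⟨l, hl⟩

variable {V : Type u} [Category.{v} V] [CartesianMonoidalCategory V] [BraidedCategory V]
  [MonoidalClosed V] [IsExtensive.{w} V] {C : Type w} [EnrichedCategory V C]
  (F : EnrichedFunctor V Cᵒᵖ V) {D : C} (x : 𝟙_ V ⟶ F.obj (op D))

/-- The generalized morphism of `∫ F` to `(D, x)` given by a generalized element of `C(A, D)`. -/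
def toElement {A : C} {U : V} (g : U ⟶ (A ⟶[V] D)) : U ⟶ elMor F :=
  lift g (toUnit U ≫ x) ≫ elι₁ F A D

theorem toElement_src {A : C} {U : V} (g : U ⟶ (A ⟶[V] D)) :
    toElement F x g ≫ elSrc F = g ≫ yonedaMap F x A ≫ elι₀ F A := by
  rw [toElement, Category.assoc, elι_src, ← Category.assoc, ← comp_yonedaMap, Category.assoc]

theorem toElement_tgt {A : C} {U : V} (g : U ⟶ (A ⟶[V] D)) :
    toElement F x g ≫ elTgt F = toUnit U ≫ x ≫ elι₀ F D := by
  rw [toElement, Category.assoc, elι_tgt, lift_snd_assoc, Category.assoc]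

theorem comp_toElement {A : C} {U U' : V} (s : U' ⟶ U) (g : U ⟶ (A ⟶[V] D)) :
    s ≫ toElement F x g = toElement F x (s ≫ g) := by
  rw [toElement, toElement, ← Category.assoc, CartesianMonoidalCategory.comp_lift,
    ← Category.assoc s, comp_toUnit]

-- The coproduct inclusion is monic, and the first projection recovers the element of `C(A, D)`.
variable {F x} in
theorem toElement_cancel {A : C} {U : V} {g g' : U ⟶ (A ⟶[V] D)}
    (h : toElement F x g = toElement F x g') : g = g' := by
  simpa using el_cancel h =≫ fst _ _

/-- A generalized morphism of `∫ F` to `(D, x)` is locally given by elements of `C(A, D)`. -/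
theorem eq_toElement {A : C} {U : V} (q : U ⟶ (A ⟶[V] D) ⊗ F.obj (op D))
    (h : (q ≫ elι₁ F A D) ≫ elTgt F = toUnit U ≫ x ≫ elι₀ F D) :
    q ≫ elι₁ F A D = toElement F x (q ≫ fst _ _) := by
  rw [Category.assoc, elι_tgt, ← Category.assoc, ← Category.assoc] at h
  -- The target is the second coordinate included in the coproduct; cancelling the inclusion shows
  -- that this coordinate is `x`.
  have e := ι_cancel (Y := elFam₀ F) (i := D) (g := q ≫ snd _ _) (g' := toUnit U ≫ x) h
  rw [toElement, ← e, ← CartesianMonoidalCategory.comp_lift, lift_fst_snd, Category.comp_id]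

/-- On a piece of `U` where `f` lies in the summand of `(A', B)`, the source lies in both `F A'` and
`F A`, and the target in both `F B` and `F D`. Unless `(A', B) = (A, D)`, disjointness makes the
piece initial, so `f` factors globally through one summand. -/
theorem exists_eq_toElement {A : C} {U : V} (f : U ⟶ elMor F) (y : U ⟶ F.obj (op A))
    (h₁ : f ≫ elSrc F = y ≫ elι₀ F A) (h₂ : f ≫ elTgt F = toUnit U ≫ x ≫ elι₀ F D) :
    ∃ g : U ⟶ (A ⟶[V] D), f = toElement F x g := by
  obtain ⟨q, hq⟩ := exists_factor f (A, D) (fun ⟨A', B⟩ U r q e hne => by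
    by_cases hA : A' = A
    · have hB : B ≠ D := fun hB => hne (by rw [hA, hB])
      refine isInitial_of_ne (Y := elFam₀ F) hB (q ≫ snd _ _) (toUnit _ ≫ x) ?_
      have := congrArg (· ≫ elTgt F) e
      simp only [Category.assoc] at this
      rw [elι_tgt, h₂, ← Category.assoc r, comp_toUnit] at this
      rw [Category.assoc, Category.assoc, this]
    · refine isInitial_of_ne (Y := elFam₀ F) hA (q ≫ ev F A' B) (r ≫ y) ?_
      have := congrArg (· ≫ elSrc F) e
      simp only [Category.assoc] at this
      rw [elι_src, h₁] at this
      rw [Category.assoc, Category.assoc, this])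
  exact ⟨q ≫ fst _ _, hq.symm.trans (eq_toElement F x q (by rw [← h₂, ← hq]))⟩

variable [HasPullbacks V]

/-- The morphism to `(D, x)` from the generalized object given by the inclusion of `F A` yields a
map `g : F A ⟶ C(A, D)`. The source condition makes it a section of `yonedaMap F x A`. -/
theorem isIso_yonedaMap_of_hasUniqueMorphismsTo
    (h : InternalCat.HasUniqueMorphismsTo (elementOf F D x)) (A : C) :
    IsIso (yonedaMap F x A) := by
  obtain ⟨f, ⟨h₁, h₂⟩, -⟩ := h (F.obj (op A)) (elι₀ F A)
  obtain ⟨g, rfl⟩ := exists_eq_toElement F x f (𝟙 _) (h₁.trans (Category.id_comp _).symm) h₂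
  have e : g ≫ yonedaMap F x A = 𝟙 _ := by
    refine ι_cancel (Y := elFam₀ F) (i := A) ?_
    rw [Category.id_comp, Category.assoc]
    exact (toElement_src F x g).symm.trans h₁
  -- For the other composite, `yonedaMap F x A ≫ g` and the identity of `C(A, D)` name morphisms to
  -- `(D, x)` with the same source, so uniqueness applies.
  refine ⟨g, toElement_cancel (F := F) (x := x) (h.hom_ext ?_ (toElement_tgt F x _)
    (toElement_tgt F x _)), e⟩
  refine (toElement_src F x _).trans (Eq.trans ?_ (toElement_src F x _).symm)
  rw [Category.assoc, reassoc_of% e, Category.id_comp]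

/-- The inverses glue over the summands `F A` to a section `t` of the source map with constant
target `(D, x)`. Composing any generalized object with `t` gives its morphism to `(D, x)`. -/
theorem hasUniqueMorphismsTo_of_isIso_yonedaMap (h : ∀ A : C, IsIso (yonedaMap F x A)) :
    InternalCat.HasUniqueMorphismsTo (elementOf F D x) := by
  let t : elObj F ⟶ elMor F := Sigma.desc fun A => toElement F x (inv (yonedaMap F x A))
  have ht : ∀ A, elι₀ F A ≫ t = toElement F x (inv (yonedaMap F x A)) :=
    fun A => Sigma.ι_desc (f := elFam₀ F) _ A
  have t₁ : t ≫ elSrc F = 𝟙 _ := by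
    apply Sigma.hom_ext
    intro A
    change elι₀ F A ≫ _ = elι₀ F A ≫ _
    rw [← Category.assoc, ht, toElement_src, IsIso.inv_hom_id_assoc, Category.comp_id]
  have t₂ : t ≫ elTgt F = toUnit _ ≫ x ≫ elι₀ F D := by
    apply Sigma.hom_ext
    intro A
    change elι₀ F A ≫ _ = elι₀ F A ≫ _
    rw [← Category.assoc, ht, toElement_tgt, ← Category.assoc (elι₀ F A), comp_toUnit]
  intro X (a : X ⟶ elObj F)
  refine ⟨a ≫ t, ⟨?_, ?_⟩, ?_⟩
  · exact (Category.assoc _ _ _).trans ((congrArg _ t₁).trans (Category.comp_id _))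
  · refine (Category.assoc _ _ _).trans ((congrArg _ t₂).trans ?_)
    exact (Category.assoc _ _ _).symm.trans (congrArg (· ≫ x ≫ elι₀ F D) (comp_toUnit a))
  · rintro (f : X ⟶ elMor F) ⟨h₁, h₂⟩
    change f ≫ elSrc F = a at h₁
    change f ≫ elTgt F = toUnit X ≫ x ≫ elι₀ F D at h₂
    -- Uniqueness is checked on the pieces cut out by the summands of the object of morphisms. There
    -- the source lies in a single `F A`, so the morphism is named by some `g` in `C(A, D)`, and
    -- `yonedaMap F x A` sends `g` to that source; invertibility determines `g`.
    refine cover_hom_ext f fun ⟨A, B⟩ U r q hr => ?_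
    have e₁ : r ≫ a = (q ≫ ev F A B) ≫ elι₀ F A := by
      rw [← h₁, reassoc_of% hr, elι_src, Category.assoc]
    have e₂ : (r ≫ f) ≫ elTgt F = toUnit U ≫ x ≫ elι₀ F D := by
      rw [Category.assoc, h₂, ← Category.assoc, comp_toUnit]
    obtain ⟨g, hg⟩ := exists_eq_toElement F x (r ≫ f) (q ≫ ev F A B)
      (by rw [Category.assoc, h₁, e₁]) e₂
    have e₃ : r ≫ a = (g ≫ yonedaMap F x A) ≫ elι₀ F A := by
      rw [← h₁, ← Category.assoc, hg, toElement_src, Category.assoc]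
    have e₄ : (r ≫ a) ≫ t = toElement F x g := by
      rw [e₃, Category.assoc, ht, comp_toElement, Category.assoc, IsIso.hom_inv_id,
        Category.comp_id]
    exact hg.trans (e₄.symm.trans (Category.assoc _ _ _))

end Elements

end VRep

end

theorem mainTheorem2 {V : Type u} [Category.{v} V] [CartesianMonoidalCategory V] [BraidedCategory V]
    [MonoidalClosed V] [HasPullbacks V] [VRep.IsExtensive.{w} V]
    {C : Type w} [EnrichedCategory V C] (F : EnrichedFunctor V Cᵒᵖ V)
    (D : C) (x : 𝟙_ V ⟶ F.obj (op D)) :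
    VRep.IsRepresentableBy F D x ↔ VRep.InternalCat.IsInternalTerminal (VRep.elementOf F D x) :=
  (VRep.isRepresentableBy_iff F x).trans <| Iff.trans
    ⟨VRep.hasUniqueMorphismsTo_of_isIso_yonedaMap F x,
      VRep.isIso_yonedaMap_of_hasUniqueMorphismsTo F x⟩ VRep.InternalCat.isInternalTerminal_iff.symm
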